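/- **Setting.** Let $\langle x,y\rangle=-x^0y^0+x^1y^1+x^2y^2+x^3y^3$ on $\mathbb{R}^4$. Hyperbolic space $\mathbb{H}^3$ (curvature $-1$) consists of the classes $[x]$ with $\langle x,x\rangle<0$; ideal points are the classes with $\langle x,x\rangle=0$, $x\ne 0$; $\mathrm{Vol}$ is the hyperbolic volume, i.e. $dy/(1-|y|^2)^2$ in the Beltrami–Klein ball. For an ideal point $E=(1,e)$, $|e|=1$, and $s\in(-1,1)$, let $B(E,s)=\{[x]\in\mathbb{H}^3 : (1+s)\langle x,E\rangle^2\le (1-s)(-\langle x,x\rangle)\}$ be the horoball centred at $E$ whose boundary passes through $(1,se)$. A horoball packing is a countable collection of horoballs such that any two distinct members $B,B'$ satisfy $\mathrm{Int}(B\cap B')=\emptyset$. Let $T$ be the regular ideal tetrahedron with vertices $$E_0=(1,0,0,1),\quad E_1=(1,0,1,0),\quad E_2=\left(1,\tfrac{\sqrt3}{2},-\tfrac12,0\right),\quad E_3=\left(1,-\tfrac{\sqrt3}{2},-\tfrac12,0\right)$$ (the cell of the honeycomb $\{3,3,6\}$), and let $\mathcal{O}=\mathcal{O}_{(3,6,3)}$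 be the orthoscheme with vertices $E_0$, the midpoint $(1,\tfrac{\sqrt3}{4},\tfrac14,0)$ of the edge $E_1E_2$, the centre $(1,0,0,0)$ of the facet $E_1E_2E_3$, and $E_1$. Let $\mathbf{T}$ be the group of isometries of $\mathbb{H}^3$ generated by the reflections in the four facets of $T$. For $s_0,s_1\in(-1,1)$ put $B_0=B(E_0,s_0)$ and $B_i=B(E_i,s_1)$ for $i=1,2,3$. Call $(s_0,s_1)$ *permissible* if $\mathrm{Int}(B_i\cap B_j)=\emptyset$ for $i\neq j$ and no $B_i$ crosses the plane of the facet of $T$ opposite to $E_i$ (tangency is allowed in both conditions). Let $\mathcal{B}=\{gB_i : g\in\mathbf{T},\ 0\le i\le 3\}$, and let $$\delta=\frac{\mathrm{Vol}(B_0\cap\mathcal{O})+\mathrm{Vol}(B_1\cap\mathcal{O})}{\mathrm{Vol}(\mathcal{O})}$$ be the density in the orthoscheme. **Proposition.** For all permissible $(s_0,s_1)$ the following hold. 1. $0<\mathrm{Vol}(\mathcal{O})<\infty$, $0<\mathrm{Vol}(T)<\infty$, and the density in the tetrahedron equals the density in the orthoscheme: $$\frac{\sum_{i=0}^{3}\mathrm{Vol}(B_i\cap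 T)}{\mathrm{Vol}(T)}=\delta.$$ 2. $\mathcal{B}$ is a horoball packing of $\mathbb{H}^3$, it is invariant under the countable group $\mathbf{T}$, and $T$ is a fundamental domain of $\mathbf{T}$ (its images under $\mathbf{T}$ cover $\mathbb{H}^3$ up to a null set and overlap pairwise in null sets only). 3. $\delta$ is the density of $\mathcal{B}$ in the whole of $\mathbb{H}^3$: for every $g\in\mathbf{T}$, $$\frac{\mathrm{Vol}\left(\bigcup\mathcal{B}\cap gT\right)}{\mathrm{Vol}(gT)}=\delta,$$ and, more generally, $\mathrm{Vol}(\bigcup\mathcal{B}\cap F)=\delta\,\mathrm{Vol}(F)$ for every fundamental domain $F$, of finite volume, of any countable group $\Gamma$ of isometries of $\mathbb{H}^3$ that maps $\mathcal{B}$ to itself. -/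

import Mathlib

open MeasureTheory Set
open scoped ENNReal

noncomputable section

namespace Honeycomb336

/-- The real vector space of dimension four, with coordinates `(x⁰, x¹, x², x³)`. -/
abbrev V4 : Type := Fin 4 → ℝ

/-- The Lorentzian form `⟨x, y⟩ = -x⁰y⁰ + x¹y¹ + x²y² + x³y³`. -/
def lor : LinearMap.BilinForm ℝ V4 :=
  LinearMap.mk₂ ℝ (fun x y => -(x 0 * y 0) + x 1 * y 1 + x 2 * y 2 + x 3 * y 3)
    (by intros; simp; ring) (by intros; simp; ring)
    (by intros; simp; ring) (by intros; simp; ring)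

theorem lor_apply (x y : V4) :
    lor x y = -(x 0 * y 0) + x 1 * y 1 + x 2 * y 2 + x 3 * y 3 := rfl

theorem lor_comm (x y : V4) : lor x y = lor y x := by
  simp only [lor_apply]; ring

/-- `x` lies on the upper sheet of the unit hyperboloid, that is, `x` is the normalized
representative of a proper point of the projective model. -/
def IsPoint (x : V4) : Prop := lor x x = -1 ∧ 0 < x 0

/-- Hyperbolic 3-space of curvature `-1`. A point `[x]` of the projective model (`⟨x, x⟩ < 0`) is
given by its representative with `⟨x, x⟩ = -1`, `x⁰ > 0`; `cosh d(x, y) = -⟨x, y⟩`. -/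
abbrev H3 : Type := {x : V4 // IsPoint x}

/-- The Beltrami--Klein chart, a bijection of `H3` onto the open unit ball. -/
def klein (x : H3) : EuclideanSpace ℝ (Fin 3) :=
  !₂[x.1 1 / x.1 0, x.1 2 / x.1 0, x.1 3 / x.1 0]

/-- The hyperbolic volume, which is `dy / (1 - |y|²)²` in the Beltrami--Klein ball. -/
def hypVol : Measure H3 :=
  (volume.withDensity fun y : EuclideanSpace ℝ (Fin 3) =>
    ENNReal.ofReal (((1 - ‖y‖ ^ 2) ^ 2)⁻¹)).comap klein

theorem klein_injective : Function.Injective klein := by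
  intro x y h
  have hx0 : x.1 0 ≠ 0 := x.2.2.ne'
  have hy0 : y.1 0 ≠ 0 := y.2.2.ne'
  have h1 : x.1 1 / x.1 0 = y.1 1 / y.1 0 := congrArg (fun v => v.ofLp 0) h
  have h2 : x.1 2 / x.1 0 = y.1 2 / y.1 0 := congrArg (fun v => v.ofLp 1) h
  have h3 : x.1 3 / x.1 0 = y.1 3 / y.1 0 := congrArg (fun v => v.ofLp 2) h
  obtain ⟨t, ht⟩ : ∃ t, t = y.1 0 / x.1 0 := ⟨_, rfl⟩
  have e0 : y.1 0 = t * x.1 0 := by rw [ht]; field_simp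
  have e1 : y.1 1 = t * x.1 1 := by rw [ht]; field_simp at h1 ⊢; linarith
  have e2 : y.1 2 = t * x.1 2 := by rw [ht]; field_simp at h2 ⊢; linarith
  have e3 : y.1 3 = t * x.1 3 := by rw [ht]; field_simp at h3 ⊢; linarith
  have hx := x.2.1
  have hy := y.2.1
  rw [lor_apply] at hx hy
  rw [e0, e1, e2, e3] at hy
  have htt : t ^ 2 = 1 := by linear_combination -hy + t ^ 2 * hx
  have htp : 0 < t := by rw [ht]; exact div_pos y.2.2 x.2.2
  have ht1 : t = 1 := by nlinarith
  apply Subtype.ext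
  funext i
  fin_cases i <;> simp [e0, e1, e2, e3, ht1]

theorem klein_measurableEmbedding : MeasurableEmbedding klein := by
  have hc : Continuous fun x : V4 => lor x x := by
    simp only [lor_apply]; fun_prop
  have hs : MeasurableSet {x : V4 | IsPoint x} :=
    ((isClosed_singleton (x := (-1 : ℝ))).preimage hc).measurableSet.inter
      (isOpen_lt continuous_const (continuous_apply 0)).measurableSet
  have : StandardBorelSpace H3 := hs.standardBorel
  refine Measurable.measurableEmbedding (Continuous.measurable ?_) klein_injective
  have hx0 : ∀ x : H3, x.1 0 ≠ 0 := fun x => x.2.2.ne'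
  refine (PiLp.continuous_toLp 2 (fun _ : Fin 3 => ℝ)).comp (continuous_pi fun i => ?_)
  have hd : ∀ j : Fin 4, Continuous fun x : H3 => x.1 j / x.1 0 := fun j =>
    ((continuous_apply j).comp continuous_subtype_val).div
      ((continuous_apply 0).comp continuous_subtype_val) hx0
  fin_cases i
  exacts [hd 1, hd 2, hd 3]

theorem hypVol_apply {A : Set H3} (hA : MeasurableSet A) :
    hypVol A = ∫⁻ y in klein '' A, ENNReal.ofReal (((1 - ‖y‖ ^ 2) ^ 2)⁻¹) := by
  rw [hypVol, klein_measurableEmbedding.comap_apply,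
    withDensity_apply _ (klein_measurableEmbedding.measurableSet_image.2 hA)]

/-- The isometry group of `H3`: the linear automorphisms of `V4` that preserve the Lorentzian form
and the upper sheet of the hyperboloid. -/
def isomGroup : Subgroup (V4 ≃ₗ[ℝ] V4) where
  carrier := {g | (∀ x y, lor (g x) (g y) = lor x y) ∧ ∀ x, IsPoint (g x) ↔ IsPoint x}
  one_mem' := ⟨fun _ _ => rfl, fun _ => Iff.rfl⟩
  mul_mem' := fun {a b} ha hb =>
    ⟨fun x y => (ha.1 (b x) (b y)).trans (hb.1 x y), fun x => (ha.2 (b x)).trans (hb.2 x)⟩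
  inv_mem' := fun {a} ha => by
    have h : ∀ x, a (a⁻¹ x) = x := fun x => a.apply_symm_apply x
    refine ⟨fun x y => ?_, fun x => ?_⟩
    · rw [← ha.1 (a⁻¹ x) (a⁻¹ y), h, h]
    · rw [← ha.2 (a⁻¹ x), h]

instance : MulAction isomGroup H3 where
  smul g x := ⟨g.1 x.1, (g.2.2 x.1).2 x.2⟩
  one_smul _ := rfl
  mul_smul _ _ _ := rfl

/-- The image of a set of points under an isometry. -/
def move (g : isomGroup) (A : Set H3) : Set H3 := (fun x : H3 => g • x) '' A

/-- The part in `H3` of the (projective) simplex with the four given vertices, which may be proper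
or ideal. -/
def simplex (v : Fin 4 → V4) : Set H3 :=
  {x | ∃ a : Fin 4 → ℝ, (∀ i, 0 ≤ a i) ∧ x.1 = ∑ i, a i • v i}

/-- The closed horoball (in `H3`) centred at the ideal point `e` (`⟨e, e⟩ = 0`, `e⁰ = 1`) whose
boundary passes through the point with Beltrami--Klein coordinates `s • (e¹, e², e³)`. -/
def horoball (e : V4) (s : ℝ) : Set H3 :=
  {x | (1 + s) * lor x.1 e ^ 2 ≤ (1 - s) * -lor x.1 x.1}

def IsHoroball (B : Set H3) : Prop :=
  ∃ (e : V4) (s : ℝ), lor e e = 0 ∧ e 0 = 1 ∧ s ∈ Ioo (-1 : ℝ) 1 ∧ B = horoball e s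

/-- A horoball packing: a countable collection of non-overlapping horoballs. -/
def IsHoroballPacking (P : Set (Set H3)) : Prop :=
  P.Countable ∧ (∀ B ∈ P, IsHoroball B) ∧
    ∀ B ∈ P, ∀ B' ∈ P, B ≠ B' → interior (B ∩ B') = ∅

/-- `Γ` is a countable group of isometries which preserves the collection `P`, and `F` is a
fundamental domain of `Γ` of finite volume. -/
def IsPeriod (P : Set (Set H3)) (Γ : Subgroup isomGroup) (F : Set H3) : Prop :=
  (Γ : Set isomGroup).Countable ∧ (∀ g ∈ Γ, ∀ B ∈ P, move g B ∈ P) ∧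
    IsFundamentalDomain Γ F hypVol ∧ 0 < hypVol F ∧ hypVol F < ∞

/-- The proportion of `D` that is covered by the collection `P`. -/
def coveredPart (P : Set (Set H3)) (D : Set H3) : ℝ≥0∞ := hypVol (⋃₀ P ∩ D) / hypVol D

/-- The collection `P` is periodic, and it has density `δ` in the whole space: it covers the
proportion `δ` of every finite-volume fundamental domain of every group of isometries that
preserves `P`. -/
def HasDensity (P : Set (Set H3)) (δ : ℝ≥0∞) : Prop :=
  (∃ Γ F, IsPeriod P Γ F) ∧ ∀ Γ F, IsPeriod P Γ F → coveredPart P F = δ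

/-- The vertices `E₀, E₁, E₂, E₃` of the regular ideal tetrahedron. -/
def vertexE : Fin 4 → V4 :=
  ![![1, 0, 0, 1], ![1, 0, 1, 0], ![1, √3 / 2, -1 / 2, 0], ![1, -√3 / 2, -1 / 2, 0]]

/-- The vertices of the characteristic orthoscheme: `E₀`, the midpoint of the edge `E₁E₂` (the foot
of the perpendicular from `E₀`), the centre of the facet `E₁E₂E₃`, and `E₁`. -/
def vertexA : Fin 4 → V4 :=
  ![![1, 0, 0, 1], ![1, √3 / 4, 1 / 4, 0], ![1, 0, 0, 0], ![1, 0, 1, 0]]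

/-- The regular ideal tetrahedron `E₀E₁E₂E₃`, the cell of the honeycomb `{3,3,6}`. -/
def cell : Set H3 := simplex vertexE

/-- The orthoscheme of Schläfli symbol `{3,6,3}`. -/
def orthoscheme : Set H3 := simplex vertexA

/-- The inward poles of the facets of the cell, the `i`-th facet being opposite to `Eᵢ`. -/
def pole : Fin 4 → V4 :=
  ![![0, 0, 0, 1], ![-1, 0, 2, -1], ![-1, √3, -1, -1], ![-1, -√3, -1, -1]]

theorem lor_pole_pos (i : Fin 4) : 0 < lor (pole i) (pole i) := by
  have h : √3 * √3 = 3 := Real.mul_self_sqrt (by norm_num)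
  fin_cases i <;> simp [pole, lor_apply] <;> nlinarith

/-- The reflection `x ↦ x - 2 ⟨x, u⟩ / ⟨u, u⟩ u` in the plane with pole `u`. -/
def reflect (u : V4) (hu : 0 < lor u u) : V4 ≃ₗ[ℝ] V4 :=
  Module.reflection (x := u) (f := (2 / lor u u) • lor u)
    (by simp only [LinearMap.smul_apply, smul_eq_mul]; field_simp)

theorem reflect_apply (u : V4) (hu : 0 < lor u u) (x : V4) :
    reflect u hu x = x - (2 * lor x u / lor u u) • u := by
  rw [reflect, Module.reflection_apply, LinearMap.smul_apply, smul_eq_mul, lor_comm u x,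
    div_mul_eq_mul_div]

theorem reflect_reflect (u : V4) (hu : 0 < lor u u) (x : V4) :
    reflect u hu (reflect u hu x) = x :=
  Module.involutive_reflection _ x

theorem lor_reflect (u : V4) (hu : 0 < lor u u) (x y : V4) :
    lor (reflect u hu x) (reflect u hu y) = lor x y := by
  simp only [reflect_apply, map_sub, map_smul, LinearMap.sub_apply, LinearMap.smul_apply,
    smul_eq_mul, lor_comm u y]
  field_simp
  ring

theorem lor_reflect_self (u : V4) (hu : 0 < lor u u) (x : V4) :
    lor x (reflect u hu x) = lor x x - 2 * lor x u ^ 2 / lor u u := by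
  simp only [reflect_apply, map_sub, map_smul, smul_eq_mul]
  ring

theorem pos_of_lor_neg {x y : V4} (hx : IsPoint x) (hy : lor y y = -1) (h : lor x y < 0) :
    0 < y 0 := by
  obtain ⟨hx1, hx0⟩ := hx
  rw [lor_apply] at hx1 hy h
  by_contra! hc
  have h1 : 0 ≤ x 0 * -y 0 := mul_nonneg hx0.le (by linarith)
  have h2 : (x 0 * -y 0) ^ 2 ≤ (-(x 1 * y 1 + x 2 * y 2 + x 3 * y 3)) ^ 2 :=
    pow_le_pow_left₀ h1 (by linarith) 2
  have h3 : x 0 ^ 2 = 1 + (x 1 ^ 2 + x 2 ^ 2 + x 3 ^ 2) := by linarith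
  have h4 : y 0 ^ 2 = 1 + (y 1 ^ 2 + y 2 ^ 2 + y 3 ^ 2) := by linarith
  have h5 : (x 0 * -y 0) ^ 2 = x 0 ^ 2 * y 0 ^ 2 := by ring
  rw [h5, h3, h4] at h2
  nlinarith [sq_nonneg (x 1 * y 2 - x 2 * y 1), sq_nonneg (x 1 * y 3 - x 3 * y 1),
    sq_nonneg (x 2 * y 3 - x 3 * y 2), sq_nonneg (x 1), sq_nonneg (x 2), sq_nonneg (x 3),
    sq_nonneg (y 1), sq_nonneg (y 2), sq_nonneg (y 3)]

theorem isPoint_reflect (u : V4) (hu : 0 < lor u u) {x : V4} (hx : IsPoint x) :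
    IsPoint (reflect u hu x) := by
  have h1 : lor (reflect u hu x) (reflect u hu x) = -1 := (lor_reflect u hu x x).trans hx.1
  refine ⟨h1, pos_of_lor_neg hx h1 ?_⟩
  have : 0 ≤ 2 * lor x u ^ 2 / lor u u := by positivity
  rw [lor_reflect_self, hx.1]
  linarith

theorem reflect_mem (u : V4) (hu : 0 < lor u u) : reflect u hu ∈ isomGroup :=
  ⟨lor_reflect u hu, fun x =>
    ⟨fun h => by simpa only [reflect_reflect] using isPoint_reflect u hu h,
      isPoint_reflect u hu⟩⟩

/-- The Coxeter group of the tiling: it is generated by the reflections in the four facets of the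
cell. -/
def coxeterT : Subgroup isomGroup :=
  Subgroup.closure (range fun i : Fin 4 => ⟨reflect (pole i) (lor_pole_pos i), reflect_mem _ _⟩)

/-- The four horoballs `B₀, B₁, B₂, B₃` of the cell, centred at `E₀, E₁, E₂, E₃`; `B₀` has parameter
`s₀`, and `B₁` and its images `B₂, B₃` under the rotations of the cell about `E₀` have parameter
`s₁`. -/
def cellHoroball (s₀ s₁ : ℝ) : Fin 4 → Set H3 :=
  ![horoball (vertexE 0) s₀, horoball (vertexE 1) s₁, horoball (vertexE 2) s₁,
    horoball (vertexE 3) s₁]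

/-- The parameters are permissible: the four horoballs of the cell do not overlap, and no one crosses
the plane of the facet opposite to its centre (tangency is allowed in both). -/
def Permissible (s₀ s₁ : ℝ) : Prop :=
  s₀ ∈ Ioo (-1 : ℝ) 1 ∧ s₁ ∈ Ioo (-1 : ℝ) 1 ∧
    (∀ i j, i ≠ j → interior (cellHoroball s₀ s₁ i ∩ cellHoroball s₀ s₁ j) = ∅) ∧
    ∀ i, ∀ x ∈ cellHoroball s₀ s₁ i, 0 ≤ lor x.1 (pole i)

/-- The collection of the images of the four horoballs under the Coxeter group. -/
def packing (s₀ s₁ : ℝ) : Set (Set H3) :=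
  {B | ∃ g ∈ coxeterT, ∃ i, B = move g (cellHoroball s₀ s₁ i)}

/-- The density in the orthoscheme, of whose vertices `E₀` and `E₁` are ideal. -/
def orthoschemeDensity (s₀ s₁ : ℝ) : ℝ≥0∞ :=
  (hypVol (cellHoroball s₀ s₁ 0 ∩ orthoscheme) + hypVol (cellHoroball s₀ s₁ 1 ∩ orthoscheme)) /
    hypVol orthoscheme

/-- The density in the tetrahedral cell. -/
def cellDensity (s₀ s₁ : ℝ) : ℝ≥0∞ :=
  (∑ i, hypVol (cellHoroball s₀ s₁ i ∩ cell)) / hypVol cell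

end Honeycomb336

end

open Honeycomb336

open scoped Pointwise

noncomputable section

namespace Honeycomb336

/-! Everything is read off in the coordinates `coord`. All dihedral angles of the cell are π/3, so
the facet reflections become integer matrices, and they preserve differences of coordinates modulo
3. A horoball is the set `-⟨x, e⟩ ≤ R` for a future null vector `e`, so the packing is governed by
the orbits of the four dual null vectors `corner j`. Integrality, the congruence and the sign of
products of future null vectors show (`map_corner`) that an image of `corner j` is either `corner j`
itself or a vector far from all four corners.

This dichotomy has three consequences. Over the cell, no image of a corner is nearer than the corner
itself (`lor_map_corner_le`), so overlapping images of the cell are equal; with a minimization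
argument for covering (`exists_map_mem_cell`), the cell is a fundamental domain. For the same reason
a packing member meets the cell only inside the horoball of the cell from which it arises
(`sUnion_packing_inter_cell`). Finally, two horoballs do not overlap as soon as `2RR' ≤ -⟨e, e'⟩`,
and permissibility bounds the radii just enough for every pair in the orbit
(`interior_inter_eq_empty`).

Volume is four times the Lebesgue measure of a truncated cone (`hypVol_eq_cone`), which makes it
invariant under isometries and reduces finiteness for the cell to an explicit cover by boxes. The
symmetries of the cell fixing `E₀` cut it into copies of the orthoscheme, whence equality of the two
densities.

For an arbitrary period group, the full symmetry group of the packing is countable and only finitely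
many of its elements move a fixed bounded set to meet itself. Any subgroup with a fundamental domain
of finite volume then has finite index, and double counting of translates shows that the covered
proportion is the same for all such domains (`measure_div_eq_of_isFundamentalDomain`). -/

/-! ### Coordinates adapted to the cell -/

/-- The coordinates `⟨v, nᵢ⟩` of a vector, where `nᵢ` is the unit normal of the `i`-th facet of the
cell. -/
def coord : V4 ≃ₗ[ℝ] (Fin 4 → ℝ) where
  toFun v := ![v 3, (v 0 + 2 * v 2 - v 3) / 2, (v 0 + √3 * v 1 - v 2 - v 3) / 2,
    (v 0 - √3 * v 1 - v 2 - v 3) / 2]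
  invFun x := ![2 / 3 * (x 1 + x 2 + x 3) + x 0, √3 * (x 2 - x 3) / 3,
    x 1 - (x 1 + x 2 + x 3) / 3, x 0]
  map_add' v w := by
    funext i; fin_cases i <;> simp <;> ring
  map_smul' c v := by
    funext i; fin_cases i <;> simp <;> ring
  left_inv v := by
    have h : √3 * √3 = 3 := Real.mul_self_sqrt (by norm_num)
    funext i
    fin_cases i <;> simp
    · ring
    · linear_combination (v 1 / 3) * h
    · ring
  right_inv x := by
    have h : √3 * √3 = 3 := Real.mul_self_sqrt (by norm_num)
    funext i
    fin_cases i <;> simp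
    · ring
    · linear_combination ((x 2 - x 3) / 6) * h
    · linear_combination (-(x 2 - x 3) / 6) * h

theorem coord_apply (v : V4) : coord v = ![v 3, (v 0 + 2 * v 2 - v 3) / 2,
    (v 0 + √3 * v 1 - v 2 - v 3) / 2, (v 0 - √3 * v 1 - v 2 - v 3) / 2] := rfl

/-- The Gram matrix of the unit normals has diagonal 1 and off-diagonal entries -1/2. Its inverse is
2/3 (I - J), with J the all-ones matrix. -/
theorem lor_eq_coord (v w : V4) : lor v w =
    2 / 3 * (∑ i, coord v i * coord w i - (∑ i, coord v i) * ∑ i, coord w i) := by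
  have h : √3 * √3 = 3 := Real.mul_self_sqrt (by norm_num)
  simp only [coord_apply, Fin.sum_univ_four, lor_apply, Matrix.cons_val]
  linear_combination (-v 1 * w 1 / 3) * h

/-- The null vector with `⟨cornerₖ, nᵢ⟩ = δₖᵢ`. -/
def corner (k : Fin 4) : V4 := coord.symm (Pi.single k 1)

@[simp] theorem coord_corner (k : Fin 4) : coord (corner k) = Pi.single k 1 :=
  coord.apply_symm_apply _

theorem lor_corner (v : V4) (k : Fin 4) :
    lor v (corner k) = -(2 / 3 * (∑ i, coord v i - coord v k)) := by
  rw [lor_eq_coord, coord_corner]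
  simp [Pi.single_apply]
  ring

theorem lor_corner_self (k : Fin 4) : lor (corner k) (corner k) = 0 := by
  rw [lor_corner]; simp

theorem lor_corner_ne {j k : Fin 4} (h : j ≠ k) : lor (corner j) (corner k) = -(2 / 3) := by
  rw [lor_corner]; simp [h]

theorem eq_sum_corner (v : V4) : v = ∑ k, coord v k • corner k := by
  apply coord.injective
  funext i
  simp [Pi.single_apply, Finset.sum_apply]

theorem lor_pole (v : V4) (i : Fin 4) :
    lor v (pole i) = (![1, 2, 2, 2] : Fin 4 → ℝ) i * coord v i := by
  fin_cases i <;> simp [lor_apply, pole, coord_apply] <;> ring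

theorem vertexE_eq (i : Fin 4) :
    vertexE i = (![1, 3 / 2, 3 / 2, 3 / 2] : Fin 4 → ℝ) i • corner i := by
  have h : √3 * √3 = 3 := Real.mul_self_sqrt (by norm_num)
  apply coord.injective
  rw [map_smul, coord_corner]
  funext j
  fin_cases i <;> fin_cases j <;> simp [vertexE, coord_apply] <;> linarith

/-- The coefficients are integers because `-2⟨nᵢ, nₖ⟩ = 1` for distinct unit normals. -/
theorem coord_reflect (k : Fin 4) (v : V4) (i : Fin 4) :
    coord (reflect (pole k) (lor_pole_pos k) v) i =
      if i = k then -coord v k else coord v i + coord v k := by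
  have h : √3 * √3 = 3 := Real.mul_self_sqrt (by norm_num)
  rw [reflect_apply, map_sub, map_smul, lor_pole, lor_pole]
  simp only [Pi.sub_apply, Pi.smul_apply, smul_eq_mul]
  fin_cases k <;> fin_cases i <;> simp [coord_apply, pole] <;> nlinarith [h]

/-! ### Inequalities of Cauchy–Schwarz type for points and future null vectors -/

/-- A nonzero vector in the closure of the future cone, on the light cone. -/
def IsFutureNull (e : V4) : Prop := lor e e = 0 ∧ 0 < e 0

theorem isFutureNull_corner (k : Fin 4) : IsFutureNull (corner k) := by
  refine ⟨lor_corner_self k, ?_⟩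
  fin_cases k <;> simp [corner, coord]

/-- A quantitative form of negativity: a bound on the product with one point confines a causal
vector to a bounded region. All finiteness arguments rest on it. -/
theorem IsPoint.apply_zero_le {x v : V4} (hx : IsPoint x) (hv : lor v v ≤ 0) (hv0 : 0 ≤ v 0) :
    v 0 ≤ 2 * x 0 * -lor x v := by
  obtain ⟨hx1, hx0⟩ := hx
  rw [lor_apply] at *
  set p := x 1 * v 1 + x 2 * v 2 + x 3 * v 3 with hp
  have hX : x 1 ^ 2 + x 2 ^ 2 + x 3 ^ 2 = x 0 ^ 2 - 1 := by linarith
  have hV : v 1 ^ 2 + v 2 ^ 2 + v 3 ^ 2 ≤ v 0 ^ 2 := by linarith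
  have hcs : p ^ 2 ≤ (x 1 ^ 2 + x 2 ^ 2 + x 3 ^ 2) * (v 1 ^ 2 + v 2 ^ 2 + v 3 ^ 2) := by
    rw [hp]
    nlinarith [sq_nonneg (x 1 * v 2 - x 2 * v 1), sq_nonneg (x 1 * v 3 - x 3 * v 1),
      sq_nonneg (x 2 * v 3 - x 3 * v 2)]
  have hX0 : 0 ≤ x 0 ^ 2 - 1 := by rw [← hX]; positivity
  have hpp : p ^ 2 ≤ (x 0 ^ 2 - 1) * v 0 ^ 2 := by
    rw [hX] at hcs
    exact hcs.trans (mul_le_mul_of_nonneg_left hV hX0)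
  have key : 2 * x 0 * p ≤ v 0 * (2 * x 0 ^ 2 - 1) := by
    refine le_of_sq_le_sq ?_ (mul_nonneg hv0 (by linarith))
    have := mul_le_mul_of_nonneg_left hpp (by positivity : 0 ≤ 4 * x 0 ^ 2)
    nlinarith [sq_nonneg (v 0)]
  have : -(x 0 * v 0) + x 1 * v 1 + x 2 * v 2 + x 3 * v 3 = -(x 0 * v 0) + p := by rw [hp]; ring
  rw [this]
  nlinarith

theorem IsPoint.lor_neg {x v : V4} (hx : IsPoint x) (hv : lor v v ≤ 0) (hv0 : 0 < v 0) :
    lor x v < 0 := by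
  have := hx.apply_zero_le hv hv0.le
  have := hx.2
  by_contra! hc
  nlinarith

theorem IsPoint.pos_of_lor_neg {x v : V4} (hx : IsPoint x) (hv : lor v v ≤ 0) (h : lor x v < 0) :
    0 < v 0 := by
  by_contra! hc
  have h1 := hx.apply_zero_le (v := -v) (by simpa using hv) (by simpa using hc)
  have := hx.2
  simp at h1
  nlinarith

theorem IsPoint.lor_nonneg {x v : V4} (hx : IsPoint x) (h : lor x v = 0) : 0 ≤ lor v v := by
  obtain ⟨hx1, hx0⟩ := hx
  rw [lor_apply] at *
  have hX : x 1 ^ 2 + x 2 ^ 2 + x 3 ^ 2 = x 0 ^ 2 - 1 := by linarith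
  have hp : x 1 * v 1 + x 2 * v 2 + x 3 * v 3 = x 0 * v 0 := by linarith
  have hcs : (x 1 * v 1 + x 2 * v 2 + x 3 * v 3) ^ 2 ≤
      (x 1 ^ 2 + x 2 ^ 2 + x 3 ^ 2) * (v 1 ^ 2 + v 2 ^ 2 + v 3 ^ 2) := by
    nlinarith [sq_nonneg (x 1 * v 2 - x 2 * v 1), sq_nonneg (x 1 * v 3 - x 3 * v 1),
      sq_nonneg (x 2 * v 3 - x 3 * v 2)]
  rw [hp, hX] at hcs
  have h2 : 0 ≤ x 0 ^ 2 * (-(v 0 * v 0) + v 1 * v 1 + v 2 * v 2 + v 3 * v 3) := by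
    nlinarith [sq_nonneg (v 1), sq_nonneg (v 2), sq_nonneg (v 3)]
  exact nonneg_of_mul_nonneg_right h2 (by positivity)

/-- The combination of `e`, `e'` and `x` below is orthogonal to `x`, hence not timelike, and its
square is the inequality multiplied by a positive factor. -/
theorem IsPoint.neg_lor_le {x e e' : V4} (hx : IsPoint x) (he : IsFutureNull e)
    (he' : IsFutureNull e') : -lor e e' ≤ 2 * (lor x e * lor x e') := by
  have ha := hx.lor_neg he.1.le he.2
  have hb := hx.lor_neg he'.1.le he'.2
  have h := hx.lor_nonneg (v := lor x e' • e + lor x e • e' + (2 * lor x e * lor x e') • x)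
    (by simp [hx.1]; ring)
  simp only [map_add, map_smul, LinearMap.add_apply, LinearMap.smul_apply, smul_eq_mul, hx.1, he.1,
    he'.1, lor_comm e' e, lor_comm e x, lor_comm e' x] at h
  have hab := mul_pos_of_neg_of_neg ha hb
  by_contra! hc
  nlinarith

theorem IsFutureNull.lor_nonpos {e e' : V4} (he : IsFutureNull e) (he' : IsFutureNull e') :
    lor e e' ≤ 0 := by
  have h1 := he.1
  have h2 := he'.1
  rw [lor_apply] at *
  have hcs : (e 1 * e' 1 + e 2 * e' 2 + e 3 * e' 3) ^ 2 ≤ (e 0 * e' 0) ^ 2 := by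
    have a1 : (e 0 * e' 0) ^ 2 = (e 1 ^ 2 + e 2 ^ 2 + e 3 ^ 2) * (e' 1 ^ 2 + e' 2 ^ 2 + e' 3 ^ 2) := by
      rw [mul_pow]; congr 1 <;> linarith
    rw [a1]
    nlinarith [sq_nonneg (e 1 * e' 2 - e 2 * e' 1), sq_nonneg (e 1 * e' 3 - e 3 * e' 1),
      sq_nonneg (e 2 * e' 3 - e 3 * e' 2)]
  have := le_of_sq_le_sq hcs (mul_pos he.2 he'.2).le
  linarith

theorem IsFutureNull.smul_eq_of_lor_eq_zero {e e' : V4} (he : IsFutureNull e)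
    (he' : IsFutureNull e') (h : lor e e' = 0) : e' 0 • e = e 0 • e' := by
  have h1 := he.1
  have h2 := he'.1
  rw [lor_apply] at *
  have key : (e' 0 * e 1 - e 0 * e' 1) ^ 2 + (e' 0 * e 2 - e 0 * e' 2) ^ 2 +
      (e' 0 * e 3 - e 0 * e' 3) ^ 2 = 0 := by
    linear_combination (e' 0) ^ 2 * h1 + (e 0) ^ 2 * h2 - 2 * e 0 * e' 0 * h
  have k1 : e' 0 * e 1 - e 0 * e' 1 = 0 := by
    rw [← sq_eq_zero_iff]; nlinarith [sq_nonneg (e' 0 * e 1 - e 0 * e' 1),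
      sq_nonneg (e' 0 * e 2 - e 0 * e' 2), sq_nonneg (e' 0 * e 3 - e 0 * e' 3)]
  have k2 : e' 0 * e 2 - e 0 * e' 2 = 0 := by
    rw [← sq_eq_zero_iff]; nlinarith [sq_nonneg (e' 0 * e 1 - e 0 * e' 1),
      sq_nonneg (e' 0 * e 2 - e 0 * e' 2), sq_nonneg (e' 0 * e 3 - e 0 * e' 3)]
  have k3 : e' 0 * e 3 - e 0 * e' 3 = 0 := by
    rw [← sq_eq_zero_iff]; nlinarith [sq_nonneg (e' 0 * e 1 - e 0 * e' 1),
      sq_nonneg (e' 0 * e 2 - e 0 * e' 2), sq_nonneg (e' 0 * e 3 - e 0 * e' 3)]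
  funext i
  fin_cases i <;> simp <;> linarith

theorem exists_isPoint : ∃ x : V4, IsPoint x := ⟨![1, 0, 0, 0], by simp [IsPoint, lor_apply]⟩

theorem IsFutureNull.map {e : V4} (he : IsFutureNull e) (g : isomGroup) :
    IsFutureNull (g.1 e) := by
  obtain ⟨x, hx⟩ := exists_isPoint
  have h1 : lor (g.1 e) (g.1 e) = 0 := (g.2.1 e e).trans he.1
  refine ⟨h1, ((g.2.2 x).2 hx).pos_of_lor_neg h1.le ?_⟩
  rw [g.2.1]
  exact hx.lor_neg he.1.le he.2

theorem IsFutureNull.smul {e : V4} (he : IsFutureNull e) {c : ℝ} (hc : 0 < c) :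
    IsFutureNull (c • e) :=
  ⟨by simp [he.1], by simpa using mul_pos hc he.2⟩

/-! ### Integral orbits of the corners -/

/-- The vector with the given integer coordinates. -/
def intVec (z : Fin 4 → ℤ) : V4 := coord.symm fun i => (z i : ℝ)

@[simp] theorem coord_intVec (z : Fin 4 → ℤ) (i : Fin 4) : coord (intVec z) i = z i := by
  simp [intVec]

theorem corner_eq_intVec (j : Fin 4) : corner j = intVec (Pi.single j 1) := by
  rw [corner, intVec]
  congr 1
  funext i
  simp [Pi.single_apply]

/-- The reflection in the `i`-th facet of the cell, as an isometry. -/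
def wall (i : Fin 4) : isomGroup := ⟨reflect (pole i) (lor_pole_pos i), reflect_mem _ _⟩

theorem wall_mem (i : Fin 4) : wall i ∈ coxeterT := Subgroup.subset_closure ⟨i, rfl⟩

theorem wall_inv (i : Fin 4) : (wall i)⁻¹ = wall i :=
  inv_eq_of_mul_eq_one_left (Subtype.ext (LinearEquiv.ext fun x => reflect_reflect _ (lor_pole_pos i) x))

theorem coord_wall (k : Fin 4) (v : V4) (i : Fin 4) :
    coord ((wall k).1 v) i = if i = k then -coord v k else coord v i + coord v k :=
  coord_reflect k v i

theorem lor_map (g : isomGroup) (x y : V4) : lor (g.1 x) (g.1 y) = lor x y := g.2.1 x y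

theorem map_inv_map (g : isomGroup) (v : V4) : (g⁻¹).1 (g.1 v) = v := g.1.symm_apply_apply v

theorem map_map_inv (g : isomGroup) (v : V4) : g.1 ((g⁻¹).1 v) = v := g.1.apply_symm_apply v

theorem lor_map_left (g : isomGroup) (x y : V4) : lor (g.1 x) y = lor x ((g⁻¹).1 y) := by
  rw [← lor_map g x, map_map_inv]

theorem coe_smul_H3 (g : isomGroup) (x : H3) : (g • x).1 = g.1 x.1 := rfl

/-- A reflection adds the same integer `z k` to every coordinate, except that the `k`-th one also
loses `3 * z k`. Differences therefore survive modulo 3. -/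
theorem exists_map_intVec {g : isomGroup} (hg : g ∈ coxeterT) (z : Fin 4 → ℤ) :
    ∃ z' : Fin 4 → ℤ, g.1 (intVec z) = intVec z' ∧
      ∀ i k, (3 : ℤ) ∣ (z' i - z' k) - (z i - z k) := by
  have hwall : ∀ (k : Fin 4) (z : Fin 4 → ℤ), ∃ z' : Fin 4 → ℤ, (wall k).1 (intVec z) = intVec z' ∧
      ∀ i l, (3 : ℤ) ∣ (z' i - z' l) - (z i - z l) := by
    intro k z
    refine ⟨fun i => if i = k then -z k else z i + z k, ?_, fun i l => ?_⟩
    · apply coord.injective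
      funext i
      rw [coord_wall]
      split_ifs with h <;> simp [h]
    · by_cases hi : i = k <;> by_cases hl : l = k <;> simp [hi, hl] <;> omega
  have hstep : ∀ (k : Fin 4) (y : isomGroup), (∃ z' : Fin 4 → ℤ, y.1 (intVec z) = intVec z' ∧
      ∀ i k, (3 : ℤ) ∣ (z' i - z' k) - (z i - z k)) → ∃ z' : Fin 4 → ℤ,
        (wall k * y).1 (intVec z) = intVec z' ∧ ∀ i k, (3 : ℤ) ∣ (z' i - z' k) - (z i - z k) := by
    rintro k y ⟨z', h1, h2⟩
    obtain ⟨z'', h3, h4⟩ := hwall k z'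
    refine ⟨z'', ?_, fun i l => ?_⟩
    · rw [← h3, ← h1]; rfl
    · have := dvd_add (h4 i l) (h2 i l)
      rwa [show z'' i - z'' l - (z' i - z' l) + (z' i - z' l - (z i - z l)) =
        z'' i - z'' l - (z i - z l) by ring] at this
  induction hg using Subgroup.closure_induction_left with
  | one => exact ⟨z, rfl, fun i k => by simp⟩
  | mul_left x hx y _ ih =>
    obtain ⟨k, rfl⟩ := hx
    exact hstep k y ih
  | inv_mul_cancel x hx y _ ih =>
    obtain ⟨k, rfl⟩ := hx
    change ∃ z' : Fin 4 → ℤ, ((wall k)⁻¹ * y).1 (intVec z) = intVec z' ∧ _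
    rw [wall_inv]
    exact hstep k y ih

theorem lor_intVec_corner (z : Fin 4 → ℤ) (k : Fin 4) :
    lor (intVec z) (corner k) = -(2 / 3 * ((∑ i, z i - z k : ℤ) : ℝ)) := by
  rw [lor_corner]; simp

/-- The integers `∑ u - u k` are products with the corners up to the factor -2/3, hence nonnegative.
If one vanishes, the image is parallel to a corner; otherwise all are at least 1, and the one for
`j` is a positive multiple of 3. -/
theorem map_corner {g : isomGroup} (hg : g ∈ coxeterT) (j : Fin 4) :
    ∃ u : Fin 4 → ℤ, g.1 (corner j) = intVec u ∧ (u = Pi.single j 1 ∨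
      (∀ k, 1 ≤ ∑ i, u i - u k) ∧ 3 ≤ ∑ i, u i - u j) := by
  obtain ⟨u, hu, hmod⟩ := exists_map_intVec hg (Pi.single j 1)
  rw [← corner_eq_intVec] at hu
  have hnull : IsFutureNull (intVec u) := hu ▸ (isFutureNull_corner j).map g
  have hN : ∀ k, 0 ≤ ∑ i, u i - u k := fun k => by
    have h1 := hnull.lor_nonpos (isFutureNull_corner k)
    rw [lor_intVec_corner] at h1
    have h2 : (0 : ℝ) ≤ ((∑ i, u i - u k : ℤ) : ℝ) := by linarith
    exact_mod_cast h2
  refine ⟨u, hu, ?_⟩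
  by_cases hz : ∃ k, ∑ i, u i - u k = 0
  · left
    obtain ⟨k, hk⟩ := hz
    have h1 : lor (intVec u) (corner k) = 0 := by rw [lor_intVec_corner, hk]; simp
    have h2 := hnull.smul_eq_of_lor_eq_zero (isFutureNull_corner k) h1
    have h3 : ∀ i, i ≠ k → u i = 0 := fun i hi => by
      have h4 := congrFun (congrArg coord h2) i
      simp [hi, (isFutureNull_corner k).2.ne'] at h4
      exact_mod_cast h4
    -- A positive multiple of another corner is excluded modulo 3: coordinate `j` and a third
    -- coordinate `l` would both be 0, whereas their difference must be 1 modulo 3.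
    have hkj : k = j := by
      by_contra hne
      obtain ⟨l, hl1, hl2⟩ : ∃ l : Fin 4, l ≠ k ∧ l ≠ j := by
        have : ∀ a b : Fin 4, ∃ l, l ≠ a ∧ l ≠ b := by decide
        exact this k j
      have h5 := hmod j l
      simp [h3 l hl1, h3 j (Ne.symm hne), hl2] at h5
    subst hkj
    have hpos : 0 < u k := by
      have h4 := congrFun (congrArg coord h2) k
      simp at h4
      have : (0 : ℝ) < u k := by
        have h5 := (isFutureNull_corner k).2
        have h6 := hnull.2
        rw [← h4] at h6
        exact (mul_pos_iff_of_pos_left h5).1 h6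
      exact_mod_cast this
    -- The inverse is integral too, so the scaling factor `u k` is a positive unit of ℤ.
    obtain ⟨w, hw, -⟩ := exists_map_intVec (inv_mem hg) (Pi.single k 1)
    rw [← corner_eq_intVec] at hw
    have huk : intVec u = (u k : ℝ) • corner k := by
      apply coord.injective
      funext i
      by_cases hi : i = k
      · subst hi; simp
      · simp [hi, h3 i hi]
    have h6 : corner k = (u k : ℝ) • intVec w := by
      rw [← hw, ← map_smul, ← huk, ← hu, map_inv_map]
    have h7 := congrFun (congrArg coord h6) k
    simp at h7
    have h8 : (1 : ℤ) = u k * w k := by exact_mod_cast h7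
    have h9 : u k = 1 := Int.eq_one_of_dvd_one hpos.le ⟨w k, h8⟩
    funext i
    by_cases hi : i = k
    · subst hi; simp [h9]
    · simp [hi, h3 i hi]
  · right
    push Not at hz
    have h1 : ∀ k, 1 ≤ ∑ i, u i - u k := fun k => by
      have := hN k; have := hz k; omega
    refine ⟨h1, ?_⟩
    -- The three coordinates other than `j` are congruent modulo 3, so their sum is divisible by 3.
    have h2 := h1 j
    simp only [Fin.sum_univ_four] at h2 ⊢
    have h3 := hmod 0 1
    have h4 := hmod 0 2
    have h5 := hmod 0 3
    have h6 := hmod 1 2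
    have h7 := hmod 1 3
    have h8 := hmod 2 3
    fin_cases j <;> simp [Pi.single_apply] at * <;> omega

theorem lor_eq_sum_corner (x v : V4) : lor x v = ∑ k, coord x k * lor v (corner k) := by
  conv_lhs => rw [eq_sum_corner x]
  simp [lor_comm v]

/-- Expand `x` in the corners with nonnegative coefficients and compare term by term. The `j`-th
term compares a negative product with 0, which gives strictness. -/
theorem lor_map_corner_le {g : isomGroup} (hg : g ∈ coxeterT) {x : V4} (hx : ∀ i, 0 ≤ coord x i)
    (j : Fin 4) : lor x (g.1 (corner j)) ≤ lor x (corner j) ∧ (g.1 (corner j) ≠ corner j →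
      0 < coord x j → lor x (g.1 (corner j)) < lor x (corner j)) := by
  obtain ⟨u, hu, rfl | ⟨h1, h3⟩⟩ := map_corner hg j
  · rw [hu, ← corner_eq_intVec]
    exact ⟨le_rfl, fun h => absurd rfl h⟩
  · rw [hu, lor_eq_sum_corner, lor_eq_sum_corner x (corner j)]
    have h4 : ∀ k, lor (intVec u) (corner k) ≤ lor (corner j) (corner k) := fun k => by
      by_cases hk : j = k
      · subst hk
        rw [lor_corner_self]
        rw [lor_intVec_corner]
        have : (1 : ℝ) ≤ ((∑ i, u i - u j : ℤ) : ℝ) := by exact_mod_cast h1 j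
        linarith
      · rw [lor_corner_ne hk, lor_intVec_corner]
        have : (1 : ℝ) ≤ ((∑ i, u i - u k : ℤ) : ℝ) := by exact_mod_cast h1 k
        linarith
    refine ⟨Finset.sum_le_sum fun k _ => mul_le_mul_of_nonneg_left (h4 k) (hx k), fun _ hj =>
      Finset.sum_lt_sum (fun k _ => mul_le_mul_of_nonneg_left (h4 k) (hx k))
        ⟨j, Finset.mem_univ _, mul_lt_mul_of_pos_left ?_ hj⟩⟩
    rw [lor_corner_self, lor_intVec_corner]
    have : (1 : ℝ) ≤ ((∑ i, u i - u j : ℤ) : ℝ) := by exact_mod_cast h1 j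
    linarith

theorem isom_ext {g h : isomGroup} (H : ∀ j, g.1 (corner j) = h.1 (corner j)) : g = h := by
  refine Subtype.ext (LinearEquiv.ext fun v => ?_)
  rw [eq_sum_corner v, map_sum, map_sum]
  simp only [map_smul, H]

/-- The inequality for `g⁻¹` at `x` and the one for `g` at `g x` are opposite to each other, and the
first is strict unless the corner is fixed. An isometry fixing all four corners is trivial. -/
theorem eq_one_of_map_mem_cell {g : isomGroup} (hg : g ∈ coxeterT) {x : V4}
    (hx : ∀ i, 0 < coord x i) (hgx : ∀ i, 0 ≤ coord (g.1 x) i) : g = 1 := by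
  have H : ∀ j, (g⁻¹).1 (corner j) = corner j := fun j => by
    by_contra hne
    have h1 := (lor_map_corner_le (inv_mem hg) (fun i => (hx i).le) j).2 hne (hx j)
    have h2 := (lor_map_corner_le hg hgx j).1
    rw [lor_map, lor_map_left] at h2
    linarith
  rw [← inv_eq_one]
  exact isom_ext H

/-! ### The simplices as coordinate inequalities, and covering by images of the cell -/

theorem cell_eq : cell = {x : H3 | ∀ i, 0 ≤ coord x.1 i} := by
  have hpos : ∀ i, 0 < (![1, 3 / 2, 3 / 2, 3 / 2] : Fin 4 → ℝ) i := fun i => by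
    fin_cases i <;> simp
  ext x
  constructor
  · rintro ⟨a, ha, hx⟩ i
    rw [hx, map_sum, Finset.sum_apply]
    refine Finset.sum_nonneg fun j _ => ?_
    rw [vertexE_eq, map_smul, map_smul, coord_corner]
    simp only [Pi.smul_apply, smul_eq_mul]
    refine mul_nonneg (ha j) (mul_nonneg (hpos j).le ?_)
    by_cases h : i = j
    · subst h; simp
    · simp [h]
  · intro hx
    refine ⟨fun i => coord x.1 i / (![1, 3 / 2, 3 / 2, 3 / 2] : Fin 4 → ℝ) i,
      fun i => div_nonneg (hx i) (hpos i).le, ?_⟩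
    conv_lhs => rw [eq_sum_corner x.1]
    refine Finset.sum_congr rfl fun i _ => ?_
    rw [vertexE_eq, smul_smul, div_mul_cancel₀ _ (hpos i).ne']

theorem orthoscheme_eq : orthoscheme = {x : H3 | (∀ i, 0 ≤ coord x.1 i) ∧
    coord x.1 2 ≤ coord x.1 1 ∧ coord x.1 3 ≤ coord x.1 2} := by
  have h0 : vertexA 0 = corner 0 := by rw [← one_smul ℝ (corner 0)]; exact vertexE_eq 0
  have h : √3 * √3 = 3 := Real.mul_self_sqrt (by norm_num)
  have hc : ∀ i, coord (vertexA i) = (![![1, 0, 0, 0], ![0, 3 / 4, 3 / 4, 0],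
      ![0, 1 / 2, 1 / 2, 1 / 2], ![0, 3 / 2, 0, 0]] : Fin 4 → Fin 4 → ℝ) i := fun i => by
    funext j
    fin_cases i <;> fin_cases j <;> simp [vertexA, coord_apply] <;> linarith
  ext x
  constructor
  · rintro ⟨a, ha, hx⟩
    have h0 := ha 0
    have h1 := ha 1
    have h2 := ha 2
    have h3 := ha 3
    have hco : ∀ i, coord x.1 i = ∑ j, a j * coord (vertexA j) i := fun i => by
      rw [hx, map_sum, Finset.sum_apply]; simp
    simp only [Fin.sum_univ_four, hc] at hco
    refine ⟨fun i => ?_, ?_, ?_⟩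
    · rw [hco]; fin_cases i <;> simp <;> linarith
    · rw [hco, hco]; simp; linarith
    · rw [hco, hco]; simp; linarith
  · rintro ⟨hx, h12, h23⟩
    refine ⟨![coord x.1 0, 4 / 3 * (coord x.1 2 - coord x.1 3), 2 * coord x.1 3,
      2 / 3 * (coord x.1 1 - coord x.1 2)], fun i => ?_, ?_⟩
    · have h0 := hx 0
      have h3 := hx 3
      fin_cases i <;> simp <;> linarith
    · apply coord.injective
      rw [map_sum]
      simp only [Fin.sum_univ_four, map_smul, hc]
      funext i
      fin_cases i <;> simp <;> ring

/-- Integer vectors in the closed future cone with bounded first entry are finite in number. -/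
theorem finite_intVec_le (M : ℝ) :
    {z : Fin 4 → ℤ | lor (intVec z) (intVec z) ≤ 0 ∧ 0 ≤ intVec z 0 ∧ intVec z 0 ≤ M}.Finite := by
  refine (Set.finite_Icc (fun _ : Fin 4 => -⌈3 * M⌉) (fun _ => ⌈3 * M⌉)).subset ?_
  rintro z ⟨h1, h0, hM⟩
  have h : √3 * √3 = 3 := Real.mul_self_sqrt (by norm_num)
  have hs : √3 ≤ 2 := by nlinarith [Real.sqrt_nonneg 3]
  have hs0 := Real.sqrt_nonneg 3
  have hb : ∀ i, |coord (intVec z) i| ≤ 3 * intVec z 0 := by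
    generalize intVec z = v at *
    rw [lor_apply] at h1
    have b1 : |v 1| ≤ v 0 := abs_le_of_sq_le_sq (by nlinarith [sq_nonneg (v 2), sq_nonneg (v 3)]) h0
    have b2 : |v 2| ≤ v 0 := abs_le_of_sq_le_sq (by nlinarith [sq_nonneg (v 1), sq_nonneg (v 3)]) h0
    have b3 : |v 3| ≤ v 0 := abs_le_of_sq_le_sq (by nlinarith [sq_nonneg (v 2), sq_nonneg (v 1)]) h0
    have b1' : |√3 * v 1| ≤ 2 * v 0 := by
      rw [abs_mul, abs_of_nonneg hs0]
      exact mul_le_mul hs b1 (abs_nonneg _) (by norm_num)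
    rw [abs_le] at b1 b2 b3 b1'
    intro i
    rw [abs_le]
    fin_cases i <;> simp [coord_apply] <;> constructor <;> linarith
  have hb' : ∀ i, |z i| ≤ ⌈3 * M⌉ := fun i => by
    have h2 : (|z i| : ℝ) ≤ ⌈3 * M⌉ := by
      have h3 := hb i
      rw [coord_intVec] at h3
      exact (h3.trans (by linarith)).trans (Int.le_ceil _)
    exact_mod_cast h2
  exact ⟨fun i => (abs_le.1 (hb' i)).1, fun i => (abs_le.1 (hb' i)).2⟩

/-- Take an image of an interior vector `ρ` of the cell nearest to `x`; it exists because the orbit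
is integral. If `x` were on the wrong side of a wall of the corresponding cell, reflecting in that
wall would bring the image nearer. -/
theorem exists_map_mem_cell (x : H3) : ∃ g ∈ coxeterT, ∀ i, 0 ≤ coord (g.1 x.1) i := by
  set ρ : V4 := intVec 1 with hρ
  have hρρ : lor ρ ρ ≤ 0 := by rw [lor_eq_coord]; simp [hρ]; norm_num
  have hρ0 : 0 < ρ 0 := by simp [hρ, intVec, coord]; norm_num
  have hneg : ∀ g : isomGroup, lor x.1 (g.1 ρ) < 0 := fun g => by
    rw [lor_comm, lor_map_left, lor_comm]
    exact ((g⁻¹).2.2 _ |>.2 x.2).lor_neg hρρ hρ0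
  set A : Set (Fin 4 → ℤ) := {z | (∃ g ∈ coxeterT, g.1 ρ = intVec z) ∧
    -lor x.1 (intVec z) ≤ -lor x.1 ρ}
  have hA : A.Finite := by
    refine (finite_intVec_le (2 * x.1 0 * -lor x.1 ρ)).subset ?_
    rintro z ⟨⟨g, hg, hz⟩, hle⟩
    have h1 : lor (intVec z) (intVec z) ≤ 0 := by rw [← hz, lor_map]; exact hρρ
    have h0 : 0 < intVec z 0 := x.2.pos_of_lor_neg h1 (hz ▸ hneg g)
    refine ⟨h1, h0.le, (x.2.apply_zero_le h1 h0.le).trans ?_⟩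
    exact mul_le_mul_of_nonneg_left hle (by linarith [x.2.2])
  have hA1 : (1 : Fin 4 → ℤ) ∈ A := ⟨⟨1, one_mem _, rfl⟩, le_rfl⟩
  obtain ⟨z, ⟨⟨g, hg, hz⟩, hle⟩, hmin⟩ :=
    Set.exists_min_image A (fun z => -lor x.1 (intVec z)) hA ⟨1, hA1⟩
  refine ⟨g⁻¹, inv_mem hg, fun i => ?_⟩
  obtain ⟨z', hz', -⟩ := exists_map_intVec (mul_mem hg (wall_mem i)) 1
  have h1 : -lor x.1 (intVec z) ≤ -lor x.1 (intVec z') := by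
    by_contra! hc
    exact absurd (hmin z' ⟨⟨_, mul_mem hg (wall_mem i), hz'⟩, hc.le.trans hle⟩) (not_le.2 hc)
  have h2 : lor x.1 ((g * wall i).1 ρ) = lor ((g⁻¹).1 x.1) ((wall i).1 ρ) := by
    rw [lor_map_left, inv_inv]; rfl
  have h3 : lor x.1 (g.1 ρ) = lor ((g⁻¹).1 x.1) ρ := by rw [lor_map_left, inv_inv]
  rw [← hz, ← hz', h2, h3] at h1
  -- With `y = g⁻¹ x`, reflecting `ρ` in wall `i` changes `-⟨y, ρ⟩` by `2 * coord y i`, since `ρ`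
  -- has all coordinates 1.
  rw [lor_eq_coord, lor_eq_coord] at h1
  simp only [coord_wall] at h1
  simp only [hρ, coord_intVec, Fin.sum_univ_four] at h1
  fin_cases i <;> simp at h1 ⊢ <;> linarith

/-! ### Hyperbolic volume as Lebesgue measure of a cone, and its invariance -/

/-- The Euclidean chart in which the ball model lives. -/
abbrev E3 : Type := EuclideanSpace ℝ (Fin 3)

/-- The splitting of a vector into its time and space components. -/
def timeSpace (v : V4) : ℝ × E3 := (v 0, !₂[v 1, v 2, v 3])

theorem measurePreserving_timeSpace : MeasurePreserving timeSpace := by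
  have h1 := volume_preserving_piFinSuccAbove (fun _ : Fin 4 => ℝ) 0
  have h2 : MeasurePreserving (Prod.map (id : ℝ → ℝ) (WithLp.toLp 2 : (Fin 3 → ℝ) → E3)) :=
    (MeasurePreserving.id volume).prod (PiLp.volume_preserving_toLp (Fin 3))
  have h3 := h2.comp h1
  convert h3 using 1
  funext v
  refine Prod.ext rfl ?_
  change _ = WithLp.toLp 2 _
  simp only [timeSpace]
  congr 1
  funext i
  fin_cases i <;> rfl

theorem norm_sq_E3 (w : E3) : ‖w‖ ^ 2 = w 0 ^ 2 + w 1 ^ 2 + w 2 ^ 2 := by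
  rw [EuclideanSpace.norm_sq_eq]; simp [Fin.sum_univ_three]

theorem lor_self_eq_timeSpace (v : V4) :
    lor v v = -((timeSpace v).1 ^ 2 - ‖(timeSpace v).2‖ ^ 2) := by
  rw [norm_sq_E3, lor_apply]; simp [timeSpace]; ring

theorem klein_eq (x : H3) : klein x = (timeSpace x.1).1⁻¹ • (timeSpace x.1).2 := by
  ext i
  fin_cases i <;> simp [klein, timeSpace] <;> ring

theorem norm_klein (x : H3) : 1 - ‖klein x‖ ^ 2 = (x.1 0 ^ 2)⁻¹ := by
  have h := x.2.1
  have h0 := x.2.2.ne'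
  rw [lor_self_eq_timeSpace] at h
  rw [klein_eq, norm_smul, mul_pow]
  have : ‖(timeSpace x.1).2‖ ^ 2 = x.1 0 ^ 2 - 1 := by
    simp only [timeSpace] at h ⊢; linarith
  rw [this]
  simp [timeSpace]
  field_simp
  ring

/-- The truncated cone `{t x : x ∈ A, 0 < t ≤ 1}`. -/
def cone (A : Set H3) : Set V4 := {v | ∃ x ∈ A, ∃ t ∈ Ioc (0 : ℝ) 1, v = t • x.1}

/-- The truncated cone in the splitting into time and space. -/
def coneSplit (A : Set H3) : Set (ℝ × E3) :=
  {p | 0 < p.1 ∧ p.1 ^ 2 - ‖p.2‖ ^ 2 ≤ 1 ∧ p.1⁻¹ • p.2 ∈ klein '' A}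

theorem timeSpace_smul (t : ℝ) (v : V4) :
    timeSpace (t • v) = (t * (timeSpace v).1, t • (timeSpace v).2) := by
  refine Prod.ext (by simp [timeSpace]) ?_
  ext i
  fin_cases i <;> simp [timeSpace]

theorem timeSpace_injective : Function.Injective timeSpace := by
  intro v w h
  have h0 : v 0 = w 0 := congrArg Prod.fst h
  have h1 : v 1 = w 1 := congrArg (fun p : ℝ × E3 => p.2 0) h
  have h2 : v 2 = w 2 := congrArg (fun p : ℝ × E3 => p.2 1) h
  have h3 : v 3 = w 3 := congrArg (fun p : ℝ × E3 => p.2 2) h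
  funext i
  fin_cases i
  exacts [h0, h1, h2, h3]

theorem cone_eq_preimage (A : Set H3) : cone A = timeSpace ⁻¹' coneSplit A := by
  ext v
  constructor
  · rintro ⟨x, hx, t, ⟨ht0, ht1⟩, rfl⟩
    have hx0 : 0 < (timeSpace x.1).1 := x.2.2
    have h := x.2.1
    rw [lor_self_eq_timeSpace] at h
    refine ⟨?_, ?_, x, hx, ?_⟩
    · rw [timeSpace_smul]; exact mul_pos ht0 hx0
    · rw [timeSpace_smul]
      simp only [norm_smul, mul_pow, Real.norm_eq_abs, sq_abs]
      nlinarith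
    · rw [timeSpace_smul, klein_eq, smul_smul, mul_inv]
      congr 1
      field_simp
  · rintro ⟨h0, h1, x, hx, hk⟩
    have hv0 : 0 < v 0 := h0
    have hx0 : 0 < x.1 0 := x.2.2
    have e1 : v = (v 0 / x.1 0) • x.1 := by
      apply timeSpace_injective
      rw [timeSpace_smul]
      have hx0' : (timeSpace x.1).1 = x.1 0 := rfl
      have hv0' : (timeSpace v).1 = v 0 := rfl
      refine Prod.ext ?_ ?_
      · rw [hx0', hv0', div_mul_cancel₀ _ hx0.ne']
      · rw [klein_eq, hx0', hv0'] at hk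
        have := congrArg (fun w => v 0 • w) hk
        simp only [smul_smul] at this
        rw [mul_inv_cancel₀ hv0.ne', one_smul] at this
        rw [← this]
        rfl
    have ht : 0 < v 0 / x.1 0 := div_pos hv0 hx0
    refine ⟨x, hx, v 0 / x.1 0, ⟨ht, ?_⟩, e1⟩
    have h2 : -lor v v ≤ 1 := by rw [lor_self_eq_timeSpace]; linarith
    rw [e1] at h2
    simp [x.2.1] at h2
    nlinarith

theorem measurableSet_coneSplit {A : Set H3} (hA : MeasurableSet A) :
    MeasurableSet (coneSplit A) := by
  refine (measurableSet_lt measurable_const measurable_fst).inter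
    ((measurableSet_le (f := fun p : ℝ × E3 => p.1 ^ 2 - ‖p.2‖ ^ 2) (by fun_prop)
      measurable_const).inter ?_)
  exact (klein_measurableEmbedding.measurableSet_image.2 hA).preimage
    (measurable_fst.inv.smul measurable_snd)

theorem lintegral_pow_three {b : ℝ} (hb : 0 ≤ b) :
    ∫⁻ t in Ioc 0 b, ENNReal.ofReal (t ^ 3) = ENNReal.ofReal (b ^ 4 / 4) := by
  rw [← ofReal_integral_eq_lintegral_ofReal]
  · rw [← intervalIntegral.integral_of_le hb, integral_pow]
    norm_num
  · exact ((continuous_pow 3).integrableOn_Icc).mono_set Ioc_subset_Icc_self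
  · filter_upwards [ae_restrict_mem measurableSet_Ioc] with t ht
    exact pow_nonneg ht.1.le 3

/-- The slice of the cone at time `t` is a part of the Klein image scaled by `t`, which contributes
the factor `t ^ 3`. Over a point `y`, time runs up to `b = (1 - ‖y‖²)^(-1/2)`, and integration
yields `b ^ 4 / 4`, a quarter of the density of `hypVol`. -/
theorem hypVol_eq_cone {A : Set H3} (hA : MeasurableSet A) : hypVol A = 4 * volume (cone A) := by
  have hm := measurableSet_coneSplit hA
  have hK := klein_measurableEmbedding.measurableSet_image.2 hA
  set K := klein '' A with hKdef
  set S : Set (ℝ × E3) := {p | 0 < p.1 ∧ p.2 ∈ K ∧ p.1 ^ 2 * (1 - ‖p.2‖ ^ 2) ≤ 1} with hS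
  have hle : MeasurableSet {p : ℝ × E3 | p.1 ^ 2 * (1 - ‖p.2‖ ^ 2) ≤ 1} :=
    measurableSet_le (by fun_prop) measurable_const
  have hSm : MeasurableSet S :=
    (measurableSet_lt measurable_const measurable_fst).inter
      ((hK.preimage measurable_snd).inter hle)
  have hslice : ∀ t : ℝ, volume (Prod.mk t ⁻¹' coneSplit A) =
      ∫⁻ y, S.indicator (fun p => ENNReal.ofReal (p.1 ^ 3)) (t, y) := by
    intro t
    by_cases ht : 0 < t
    · have e1 : Prod.mk t ⁻¹' coneSplit A = (fun w : E3 => t⁻¹ • w) ⁻¹' (Prod.mk t ⁻¹' S) := by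
        ext w
        simp only [coneSplit, hS, mem_preimage, mem_ofPred_eq, ht, true_and, norm_smul, mul_pow,
          norm_inv, Real.norm_eq_abs, sq_abs, inv_pow]
        rw [and_comm, mul_sub, ← mul_assoc, mul_inv_cancel₀ (by positivity : t ^ 2 ≠ 0), mul_one,
          one_mul]
      rw [e1, Measure.addHaar_preimage_smul _ (inv_ne_zero ht.ne')]
      have e2 : ∀ y, S.indicator (fun p : ℝ × E3 => ENNReal.ofReal (p.1 ^ 3)) (t, y) =
          (Prod.mk t ⁻¹' S).indicator (fun _ => ENNReal.ofReal (t ^ 3)) y := fun y => rfl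
      simp_rw [e2]
      rw [lintegral_indicator_const (measurable_prodMk_left hSm)]
      simp [abs_of_pos ht]
    · have e1 : Prod.mk t ⁻¹' coneSplit A = ∅ := by
        ext w; simp [coneSplit, ht]
      rw [e1, measure_empty]
      symm
      have e2 : ∀ y, S.indicator (fun p : ℝ × E3 => ENNReal.ofReal (p.1 ^ 3)) (t, y) = 0 :=
        fun y => indicator_of_notMem (by simp [hS, ht]) _
      simp [e2]
  have hinner : ∀ y : E3, ∫⁻ t, S.indicator (fun p => ENNReal.ofReal (p.1 ^ 3)) (t, y) =
      K.indicator (fun y => ENNReal.ofReal (((1 - ‖y‖ ^ 2) ^ 2)⁻¹ / 4)) y := by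
    intro y
    by_cases hy : y ∈ K
    · rw [indicator_of_mem hy]
      have hpos : 0 < 1 - ‖y‖ ^ 2 := by
        obtain ⟨x, -, rfl⟩ := hy
        rw [norm_klein]
        have := x.2.2
        positivity
      set b := (√(1 - ‖y‖ ^ 2))⁻¹ with hb
      have hb0 : 0 ≤ b := by positivity
      have hb2 : b ^ 2 = (1 - ‖y‖ ^ 2)⁻¹ := by rw [hb, inv_pow, Real.sq_sqrt hpos.le]
      have e1 : ∀ t, S.indicator (fun p : ℝ × E3 => ENNReal.ofReal (p.1 ^ 3)) (t, y) =
          (Ioc 0 b).indicator (fun t => ENNReal.ofReal (t ^ 3)) t := by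
        intro t
        have : (t, y) ∈ S ↔ t ∈ Ioc 0 b := by
          simp only [hS, mem_ofPred_eq, hy, true_and, mem_Ioc]
          refine and_congr_right fun ht => ?_
          rw [← abs_of_pos ht, ← abs_of_nonneg hb0, ← sq_le_sq, hb2, le_inv_comm₀ (by positivity) hpos,
            sq_abs, le_inv_comm₀ hpos (by positivity), ← one_div, le_div_iff₀ hpos]
        by_cases h : t ∈ Ioc 0 b
        · rw [indicator_of_mem h, indicator_of_mem (this.2 h)]
        · rw [indicator_of_notMem h, indicator_of_notMem (mt this.1 h)]
      simp_rw [e1]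
      rw [lintegral_indicator measurableSet_Ioc, lintegral_pow_three hb0]
      congr 2
      rw [← inv_pow, ← hb2]
      ring
    · rw [indicator_of_notMem hy]
      have e2 : ∀ t, S.indicator (fun p : ℝ × E3 => ENNReal.ofReal (p.1 ^ 3)) (t, y) = 0 :=
        fun t => indicator_of_notMem (by simp [hS, hy]) _
      simp [e2]
  rw [hypVol_apply hA, cone_eq_preimage,
    measurePreserving_timeSpace.measure_preimage hm.nullMeasurableSet, Measure.volume_eq_prod,
    Measure.prod_apply hm]
  simp_rw [hslice]
  rw [lintegral_lintegral_swap]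
  · simp_rw [hinner]
    rw [lintegral_indicator hK, ← lintegral_const_mul']
    · refine lintegral_congr fun y => ?_
      rw [show (4 : ℝ≥0∞) = ENNReal.ofReal 4 by simp, ← ENNReal.ofReal_mul (by norm_num)]
      congr 1
      ring
    · simp
  · exact (Measurable.indicator (by fun_prop) hSm).aemeasurable

theorem continuous_isom (g : isomGroup) : Continuous g.1 :=
  LinearMap.continuous_of_finiteDimensional (g.1 : V4 →ₗ[ℝ] V4)

theorem continuous_coord : Continuous coord :=
  LinearMap.continuous_of_finiteDimensional (coord : V4 →ₗ[ℝ] (Fin 4 → ℝ))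

theorem continuous_coord_apply (i : Fin 4) : Continuous fun v : V4 => coord v i :=
  (continuous_apply i).comp continuous_coord

theorem continuous_lor : Continuous fun p : V4 × V4 => lor p.1 p.2 := by
  simp only [lor_apply]; fun_prop

instance : ContinuousConstSMul isomGroup H3 where
  continuous_const_smul g :=
    ((continuous_isom g).comp continuous_subtype_val).subtype_mk fun x => (g.2.2 x.1).2 x.2

instance (Γ : Subgroup isomGroup) : ContinuousConstSMul Γ H3 where
  continuous_const_smul g := continuous_const_smul g.1

/-- Compare determinants of the Gram matrices of the form and of its pullback, which coincide. -/
theorem det_isom_sq (g : isomGroup) : LinearMap.det (g.1 : V4 →ₗ[ℝ] V4) ^ 2 = 1 := by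
  have h1 : LinearMap.BilinForm.comp lor (g.1 : V4 →ₗ[ℝ] V4) (g.1 : V4 →ₗ[ℝ] V4) = lor :=
    LinearMap.ext₂ fun x y => g.2.1 x y
  have h2 := congrArg (fun B => (LinearMap.BilinForm.toMatrix' B).det) h1
  simp only [LinearMap.BilinForm.toMatrix'_comp, Matrix.det_mul, Matrix.det_transpose,
    LinearMap.det_toMatrix'] at h2
  have h3 : (LinearMap.BilinForm.toMatrix' lor).det ≠ 0 := by
    have : LinearMap.BilinForm.toMatrix' lor = Matrix.diagonal ![-1, 1, 1, 1] := by
      ext i j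
      rw [LinearMap.BilinForm.toMatrix'_apply]
      fin_cases i <;> fin_cases j <;> simp [lor_apply]
    rw [this, Matrix.det_diagonal]
    simp [Fin.prod_univ_four]
  have h4 := mul_right_cancel₀ h3 (show LinearMap.det (g.1 : V4 →ₗ[ℝ] V4) ^ 2 *
    (LinearMap.BilinForm.toMatrix' lor).det = 1 * (LinearMap.BilinForm.toMatrix' lor).det by
      linarith)
  exact h4

theorem cone_preimage_smul (g : isomGroup) (A : Set H3) :
    cone ((fun x => g • x) ⁻¹' A) = g.1 ⁻¹' cone A := by
  ext v
  constructor
  · rintro ⟨x, hx, t, ht, rfl⟩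
    exact ⟨g • x, hx, t, ht, map_smul g.1 t x.1⟩
  · rintro ⟨x, hx, t, ht, h⟩
    refine ⟨g⁻¹ • x, by simpa using hx, t, ht, ?_⟩
    rw [← map_inv_map g v, h, map_smul]
    rfl

theorem hypVol_preimage_smul (g : isomGroup) {A : Set H3} (hA : MeasurableSet A) :
    hypVol ((fun x => g • x) ⁻¹' A) = hypVol A := by
  have hd := det_isom_sq g
  have hd0 : LinearMap.det (g.1 : V4 →ₗ[ℝ] V4) ≠ 0 := fun h => by simp [h] at hd
  rw [hypVol_eq_cone (hA.preimage (measurable_const_smul g)), hypVol_eq_cone hA,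
    cone_preimage_smul]
  have h := Measure.addHaar_preimage_linearMap volume hd0 (cone A)
  rw [LinearEquiv.coe_coe] at h
  rw [h, abs_inv, show |LinearMap.det (g.1 : V4 →ₗ[ℝ] V4)| = 1 by
    rw [← sq_eq_sq₀ (abs_nonneg _) zero_le_one, sq_abs, hd, one_pow]]
  simp

instance : SMulInvariantMeasure isomGroup H3 hypVol where
  measure_preimage_smul g _ hA := hypVol_preimage_smul g hA

instance (Γ : Subgroup isomGroup) : SMulInvariantMeasure Γ H3 hypVol where
  measure_preimage_smul g _ hA := hypVol_preimage_smul g.1 hA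

theorem hypVol_move (g : isomGroup) (A : Set H3) : hypVol (move g A) = hypVol A :=
  measure_smul hypVol g A

theorem hypVol_hyperplane {f : V4 →ₗ[ℝ] ℝ} (hf : f ≠ 0) : hypVol {x : H3 | f x.1 = 0} = 0 := by
  have hm : MeasurableSet {x : H3 | f x.1 = 0} :=
    (isClosed_eq ((LinearMap.continuous_of_finiteDimensional f).comp continuous_subtype_val)
      continuous_const).measurableSet
  rw [hypVol_eq_cone hm]
  have : volume (cone {x : H3 | f x.1 = 0}) = 0 := by
    refine measure_mono_null (t := (LinearMap.ker f : Set V4)) ?_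
      (Measure.addHaar_submodule _ _ fun h => hf (LinearMap.ker_eq_top.1 h))
    rintro v ⟨x, hx, t, -, rfl⟩
    have hx' : f x.1 = 0 := hx
    simp [hx']
  rw [this, mul_zero]

/-! ### Positivity and finiteness of volumes -/

theorem mem_cone {A : Set H3} {v : V4} (h0 : 0 < v 0) (h1 : lor v v < 0) (h2 : -1 ≤ lor v v)
    (h : ∀ (x : H3) (c : ℝ), 0 < c → c ^ 2 * -lor v v = 1 → x.1 = c • v → x ∈ A) : v ∈ cone A := by
  have hs : 0 < √(-lor v v) := Real.sqrt_pos.2 (by linarith)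
  have hss : √(-lor v v) ^ 2 = -lor v v := Real.sq_sqrt (by linarith)
  have hc : (√(-lor v v))⁻¹ ^ 2 * -lor v v = 1 := by
    rw [inv_pow, hss, inv_mul_cancel₀ (by linarith)]
  refine ⟨⟨(√(-lor v v))⁻¹ • v, ?_, ?_⟩, h _ _ (inv_pos.2 hs) hc rfl, √(-lor v v), ⟨hs, ?_⟩, ?_⟩
  · simp; linarith
  · simpa using mul_pos (inv_pos.2 hs) h0
  · exact Real.sqrt_le_iff.2 ⟨zero_le_one, by linarith⟩
  · simp [smul_smul, hs.ne']

theorem hypVol_pos_of_subset_cone {A : Set H3} (hA : MeasurableSet A) {U : Set V4} (hU : IsOpen U)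
    (hne : U.Nonempty) (hUA : U ⊆ cone A) : 0 < hypVol A := by
  rw [hypVol_eq_cone hA]
  exact ENNReal.mul_pos (by simp) ((hU.measure_pos volume hne).trans_le (measure_mono hUA)).ne'

theorem measurableSet_cell : MeasurableSet cell := by
  rw [cell_eq, ofPred_forall]
  exact MeasurableSet.iInter fun i => (isClosed_le continuous_const
    ((continuous_coord_apply i).comp continuous_subtype_val)).measurableSet

theorem measurableSet_orthoscheme : MeasurableSet orthoscheme := by
  have h : ∀ i, Continuous fun x : H3 => coord x.1 i := fun i =>
    (continuous_coord_apply i).comp continuous_subtype_val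
  have := measurableSet_cell
  rw [cell_eq] at this
  rw [orthoscheme_eq]
  exact this.inter ((isClosed_le (h 2) (h 1)).measurableSet.inter
    (isClosed_le (h 3) (h 2)).measurableSet)

theorem orthoscheme_subset_cell : orthoscheme ⊆ cell := by
  rw [orthoscheme_eq, cell_eq]
  exact fun x hx => hx.1

theorem lor_self_eq_coord (v : V4) : lor v v = -(4 / 3 * (coord v 0 * coord v 1 +
    coord v 0 * coord v 2 + coord v 0 * coord v 3 + coord v 1 * coord v 2 + coord v 1 * coord v 3 +
    coord v 2 * coord v 3)) := by
  rw [lor_eq_coord]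
  simp only [Fin.sum_univ_four]
  ring

theorem apply_zero_eq_coord (v : V4) :
    v 0 = 2 / 3 * (coord v 1 + coord v 2 + coord v 3) + coord v 0 := by
  simp [coord_apply]; ring

theorem hypVol_orthoscheme_pos : 0 < hypVol orthoscheme := by
  refine hypVol_pos_of_subset_cone measurableSet_orthoscheme
    (U := {v | 0 < coord v 0 ∧ 0 < coord v 3 ∧ coord v 3 < coord v 2 ∧ coord v 2 < coord v 1 ∧
      -1 < lor v v}) ?_ ?_ ?_
  · have h := continuous_coord_apply
    refine (isOpen_lt continuous_const (h 0)).inter ((isOpen_lt continuous_const (h 3)).inter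
      ((isOpen_lt (h 3) (h 2)).inter ((isOpen_lt (h 2) (h 1)).inter ?_)))
    exact isOpen_lt continuous_const (continuous_lor.comp (continuous_id.prodMk continuous_id))
  · refine ⟨coord.symm ![1 / 10, 3 / 10, 2 / 10, 1 / 10], ?_⟩
    simp only [mem_ofPred_eq, lor_self_eq_coord, LinearEquiv.apply_symm_apply, Matrix.cons_val]
    norm_num
  · rintro v ⟨h0, h3, h32, h21, hl⟩
    have h2 := h3.trans h32
    have h1 := h2.trans h21
    refine mem_cone ?_ ?_ hl.le fun x c hc _ hx => ?_
    · rw [apply_zero_eq_coord v]; positivity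
    · rw [lor_self_eq_coord, neg_lt_zero]; positivity
    · rw [orthoscheme_eq]
      simp only [mem_ofPred_eq, hx, map_smul, Pi.smul_apply, smul_eq_mul]
      refine ⟨fun i => mul_nonneg hc.le ?_, by gcongr, by gcongr⟩
      fin_cases i
      exacts [h0.le, h1.le, h2.le, h3.le]

/-- This region contains the cone over the cell in the coordinates `coord`. It has four cusps along
the axes, where the largest coordinate forces the others to be small: the part with largest
coordinate in `[n, n + 1]` fits in a box of volume `8 / (n + 1)³`, a summable sequence. -/
theorem volume_box_lt_top : volume {y : Fin 4 → ℝ | (∀ i, 0 ≤ y i) ∧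
    y 0 * y 1 + y 0 * y 2 + y 0 * y 3 + y 1 * y 2 + y 1 * y 3 + y 2 * y 3 ≤ 3 / 4} < ∞ := by
  set lo : Fin 4 → ℕ → Fin 4 → ℝ := fun i n => Pi.single i (n : ℝ)
  set hi : Fin 4 → ℕ → Fin 4 → ℝ := fun i n j => if j = i then n + 1 else 2 / (n + 1)
  have hsub : {y : Fin 4 → ℝ | (∀ i, 0 ≤ y i) ∧
      y 0 * y 1 + y 0 * y 2 + y 0 * y 3 + y 1 * y 2 + y 1 * y 3 + y 2 * y 3 ≤ 3 / 4} ⊆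
      ⋃ i, ⋃ n, Icc (lo i n) (hi i n) := by
    rintro y ⟨hy, hle⟩
    obtain ⟨i, -, hmax⟩ := Finset.exists_max_image Finset.univ y ⟨0, Finset.mem_univ _⟩
    have hmax' : ∀ j, y j ≤ y i := fun j => hmax j (Finset.mem_univ _)
    refine mem_iUnion₂.2 ⟨i, ⌊y i⌋₊, ?_⟩
    have hf1 := Nat.floor_le (hy i)
    have hf2 := Nat.lt_floor_add_one (y i)
    set n := ⌊y i⌋₊
    have hprod : ∀ j, j ≠ i → y j * y i ≤ 3 / 4 := by
      intro j hj
      have := fun a b => mul_nonneg (hy a) (hy b)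
      have h01 := this 0 1
      have h02 := this 0 2
      have h03 := this 0 3
      have h12 := this 1 2
      have h13 := this 1 3
      have h23 := this 2 3
      clear hmax hmax' hf1 hf2
      clear_value n
      fin_cases i <;> fin_cases j <;> simp at hj ⊢ <;> linarith
    constructor
    · intro j
      by_cases hj : j = i
      · subst hj; simpa [lo] using hf1
      · simpa [lo, hj] using hy j
    · intro j
      by_cases hj : j = i
      · subst hj; simpa [hi] using hf2.le
      · simp only [hi, hj, if_false]
        rw [le_div_iff₀ (by positivity)]
        have h1 := hprod j hj
        have h2 := hmax' j
        have h3 := hy j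
        -- The bounds `y j ≤ 1` and `y j * n ≤ 3 / 4` add up to `y j * (n + 1) ≤ 7 / 4`, so side 2 /
        -- (n + 1) suffices, including for `n = 0`.
        have h4 : y j * y j ≤ 3 / 4 := (mul_le_mul_of_nonneg_left h2 h3).trans h1
        have h5 : y j ≤ 1 := by nlinarith
        have h6 : y j * n ≤ 3 / 4 := (mul_le_mul_of_nonneg_left hf1 h3).trans h1
        linarith
  refine (measure_mono hsub).trans_lt ((measure_iUnion_le _).trans_lt ?_)
  rw [tsum_fintype]
  refine ENNReal.sum_lt_top.2 fun i _ => (measure_iUnion_le _).trans_lt ?_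
  have hvol : ∀ n : ℕ, volume (Icc (lo i n) (hi i n)) = ENNReal.ofReal (8 * (1 / ((n : ℝ) + 1) ^ 3)) := by
    intro n
    rw [Real.volume_Icc_pi, ← ENNReal.ofReal_prod_of_nonneg]
    · congr 1
      rw [Fin.prod_univ_four]
      fin_cases i <;> simp [lo, hi] <;> field_simp <;> norm_num
    · intro j _
      by_cases hj : j = i
      · subst hj; simp [lo, hi]
      · simp [lo, hi, hj]; positivity
  simp_rw [hvol]
  have hs : Summable fun n : ℕ => 8 * (1 / ((n : ℝ) + 1) ^ 3) := by
    have := (summable_nat_add_iff 1).2 (Real.summable_one_div_nat_pow (p := 3).2 (by norm_num))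
    simpa using this.mul_left 8
  rw [← ENNReal.ofReal_tsum_of_nonneg (fun n => by positivity) hs]
  exact ENNReal.ofReal_lt_top

theorem hypVol_cell_lt_top : hypVol cell < ∞ := by
  rw [hypVol_eq_cone measurableSet_cell]
  refine ENNReal.mul_lt_top (by simp) ?_
  have hdet : LinearMap.det (coord : V4 →ₗ[ℝ] V4) ≠ 0 := coord.isUnit_det'.ne_zero
  have h := Measure.addHaar_preimage_linearMap volume hdet {y : Fin 4 → ℝ | (∀ i, 0 ≤ y i) ∧
    y 0 * y 1 + y 0 * y 2 + y 0 * y 3 + y 1 * y 2 + y 1 * y 3 + y 2 * y 3 ≤ 3 / 4}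
  refine (measure_mono ?_).trans_lt (h.trans_lt (ENNReal.mul_lt_top ENNReal.ofReal_lt_top
    volume_box_lt_top))
  rintro v ⟨x, hx, t, ⟨ht0, ht1⟩, rfl⟩
  rw [cell_eq] at hx
  refine ⟨fun i => ?_, ?_⟩
  · simpa using mul_nonneg ht0.le (hx i)
  · have h1 := lor_self_eq_coord (t • x.1)
    have h2 : lor (t • x.1) (t • x.1) = -(t * t) := by simp [x.2.1]
    rw [h2] at h1
    have : t * t ≤ 1 := by nlinarith
    simp only [LinearEquiv.coe_coe]
    linarith

theorem hypVol_cell_pos : 0 < hypVol cell :=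
  hypVol_orthoscheme_pos.trans_le (measure_mono orthoscheme_subset_cell)

theorem hypVol_orthoscheme_lt_top : hypVol orthoscheme < ∞ :=
  (measure_mono orthoscheme_subset_cell).trans_lt hypVol_cell_lt_top

/-- A bounded neighbourhood of the centre of the ball model. -/
def core : Set H3 := {x | x.1 0 < 2}

theorem measurableSet_core : MeasurableSet core :=
  (isOpen_lt ((continuous_apply 0).comp continuous_subtype_val) continuous_const).measurableSet

theorem hypVol_core_pos : 0 < hypVol core := by
  have hl : Continuous fun v : V4 => lor v v :=
    continuous_lor.comp (continuous_id.prodMk continuous_id)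
  refine hypVol_pos_of_subset_cone measurableSet_core
    (U := {v | 0 < v 0 ∧ lor v v < 0 ∧ -1 < lor v v ∧ v 0 ^ 2 < 4 * -lor v v}) ?_ ?_ ?_
  · exact (isOpen_lt continuous_const (continuous_apply 0)).inter ((isOpen_lt hl continuous_const).inter
      ((isOpen_lt continuous_const hl).inter (isOpen_lt ((continuous_apply 0).pow 2) (by fun_prop))))
  · refine ⟨![1 / 2, 0, 0, 0], ?_⟩
    simp [lor_apply]
    norm_num
  · rintro v ⟨h0, h1, h2, h3⟩
    refine mem_cone h0 h1 h2.le fun x c hc hcv hx => ?_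
    have : x.1 0 = c * v 0 := by rw [hx]; simp
    change x.1 0 < 2
    rw [this]
    have : (c * v 0) ^ 2 < 2 ^ 2 := by
      have := mul_lt_mul_of_pos_left h3 (by positivity : 0 < c ^ 2)
      nlinarith
    exact lt_of_pow_lt_pow_left₀ 2 (by norm_num) this

/-! ### Horoballs as sublevel sets of null vectors -/

/-- The horoball `{x : -⟨x, e⟩ ≤ R}` centred at the class of the future null vector `e`. -/
def ball (e : V4) (R : ℝ) : Set H3 := {x | -lor x.1 e ≤ R}

theorem continuous_lor_left (e : V4) : Continuous fun x : H3 => lor x.1 e :=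
  continuous_lor.comp (continuous_subtype_val.prodMk continuous_const)

theorem measurableSet_ball (e : V4) (R : ℝ) : MeasurableSet (ball e R) :=
  (isClosed_le (continuous_lor_left e).neg continuous_const).measurableSet

theorem move_eq_smul (g : isomGroup) (A : Set H3) : move g A = g • A := rfl

theorem move_ball (g : isomGroup) (e : V4) (R : ℝ) : move g (ball e R) = ball (g.1 e) R := by
  ext x
  rw [move_eq_smul, mem_smul_set_iff_inv_smul_mem]
  change -lor ((g⁻¹).1 x.1) e ≤ R ↔ -lor x.1 (g.1 e) ≤ R
  rw [lor_map_left, inv_inv]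

theorem ball_smul (e : V4) {c : ℝ} (hc : 0 < c) (R : ℝ) : ball (c • e) R = ball e (R / c) := by
  ext x
  simp only [ball, mem_ofPred_eq, map_smul, smul_eq_mul, le_div_iff₀ hc]
  rw [neg_mul, mul_comm]

/-- The bound on `-⟨x, e⟩` which corresponds to the parameter `s` of a horoball. -/
def radius (s : ℝ) : ℝ := √((1 - s) / (1 + s))

theorem radius_pos {s : ℝ} (hs : s ∈ Ioo (-1 : ℝ) 1) : 0 < radius s :=
  Real.sqrt_pos.2 (div_pos (by linarith [hs.2]) (by linarith [hs.1]))

theorem horoball_eq_ball {e : V4} (he : IsFutureNull e) {s : ℝ} (hs : s ∈ Ioo (-1 : ℝ) 1) :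
    horoball e s = ball e (radius s) := by
  ext x
  have h1 : 0 < 1 + s := by linarith [hs.1]
  have hneg := x.2.lor_neg he.1.le he.2
  change (1 + s) * lor x.1 e ^ 2 ≤ (1 - s) * -lor x.1 x.1 ↔ -lor x.1 e ≤ √((1 - s) / (1 + s))
  rw [x.2.1, Real.le_sqrt' (by linarith), le_div_iff₀ h1]
  constructor <;> intro h <;> linarith

theorem isHoroball_ball {e : V4} (he : IsFutureNull e) {R : ℝ} (hR : 0 < R) :
    IsHoroball (ball e R) := by
  have he0 := he.2
  have hn : IsFutureNull ((e 0)⁻¹ • e) := he.smul (inv_pos.2 he0)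
  set q := R / e 0 with hq
  have hq0 : 0 < q := div_pos hR he0
  have hs : (1 - q ^ 2) / (1 + q ^ 2) ∈ Ioo (-1 : ℝ) 1 := by
    constructor
    · rw [lt_div_iff₀ (by positivity)]; linarith
    · rw [div_lt_one (by positivity)]; nlinarith
  refine ⟨(e 0)⁻¹ • e, (1 - q ^ 2) / (1 + q ^ 2), hn.1, by simp [he0.ne'], hs, ?_⟩
  rw [horoball_eq_ball hn hs, ball_smul _ (inv_pos.2 he0)]
  congr 1
  have : (1 - (1 - q ^ 2) / (1 + q ^ 2)) / (1 + (1 - q ^ 2) / (1 + q ^ 2)) = q ^ 2 := by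
    field_simp; ring
  rw [radius, this, Real.sqrt_sq hq0.le, hq]
  field_simp

open Filter Topology in
theorem lt_of_mem_interior_ball {e : V4} (he : IsFutureNull e) {R : ℝ} {x : H3}
    (hx : x ∈ interior (ball e R)) : -lor x.1 e < R := by
  obtain ⟨O, hO, hOx⟩ := isOpen_induced_iff.1 (isOpen_interior (s := ball e R))
  set a := -lor x.1 e with ha
  have ha0 : 0 < a := by linarith [x.2.lor_neg he.1.le he.2]
  -- This is the geodesic through `x` with end `e`. For small `t < 0` it moves away from `e`, with
  -- `-⟨c t, e⟩ = a / r > a`, yet stays in the interior.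
  set c : ℝ → V4 := fun t => (√(1 + 2 * t * a))⁻¹ • (x.1 + t • e) with hc
  have hc0 : c 0 = x.1 := by simp [hc]
  have hcont : ContinuousAt c 0 := by
    have h1 : ContinuousAt (fun t : ℝ => (√(1 + 2 * t * a))⁻¹) 0 :=
      ContinuousAt.inv₀ (by fun_prop) (by simp)
    exact h1.smul (by fun_prop)
  have h1 : ∀ᶠ t in 𝓝[<] (0 : ℝ), c t ∈ O := by
    refine nhdsWithin_le_nhds (hcont.eventually (hO.mem_nhds ?_))
    rw [hc0]
    change x ∈ Subtype.val ⁻¹' O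
    rwa [hOx]
  have h2 : ∀ᶠ t in 𝓝[<] (0 : ℝ), 0 < 1 + 2 * t * a := by
    have : Continuous fun t : ℝ => 1 + 2 * t * a := by fun_prop
    exact nhdsWithin_le_nhds ((isOpen_lt continuous_const this).mem_nhds (by simp))
  obtain ⟨t, ht1, ht2, ht3⟩ := (h1.and (h2.and self_mem_nhdsWithin)).exists
  have ht3 : t < 0 := ht3
  set r := √(1 + 2 * t * a) with hr
  have hr0 : 0 < r := Real.sqrt_pos.2 ht2
  have hrr : r ^ 2 = 1 + 2 * t * a := Real.sq_sqrt ht2.le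
  have hr1 : r < 1 := by
    have : t * a < 0 := mul_neg_of_neg_of_pos ht3 ha0
    nlinarith
  have hle : lor (c t) e = -a * r⁻¹ := by
    simp only [hc, ← hr, map_smul, map_add, LinearMap.smul_apply, LinearMap.add_apply, smul_eq_mul,
      he.1]
    rw [show lor x.1 e = -a by rw [ha]; ring]
    ring
  have hlor : lor (c t) (c t) = -1 := by
    simp only [hc, ← hr, map_smul, map_add, LinearMap.smul_apply, LinearMap.add_apply, smul_eq_mul,
      he.1, x.2.1, lor_comm e x.1]
    rw [show lor x.1 e = -a by rw [ha]; ring]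
    field_simp
    linarith
  have hpt : IsPoint (c t) := by
    refine ⟨hlor, ?_⟩
    have hxc : lor x.1 (c t) < 0 := by
      simp only [hc, ← hr, map_smul, map_add, smul_eq_mul, x.2.1]
      rw [show lor x.1 e = -a by rw [ha]; ring]
      refine mul_neg_of_pos_of_neg (inv_pos.2 hr0) ?_
      nlinarith
    exact x.2.pos_of_lor_neg (by rw [hlor]; norm_num) hxc
  have hmem : (⟨c t, hpt⟩ : H3) ∈ ball e R := by
    apply interior_subset
    rw [← hOx]
    exact ht1
  have h3 : -lor (c t) e ≤ R := hmem
  rw [hle] at h3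
  have h4 : 1 < r⁻¹ := (one_lt_inv₀ hr0).2 hr1
  nlinarith

theorem interior_ball_inter_eq_empty {e e' : V4} (he : IsFutureNull e) (he' : IsFutureNull e')
    {R R' : ℝ} (hR : 0 < R) (h : 2 * (R * R') ≤ -lor e e') :
    interior (ball e R ∩ ball e' R') = ∅ := by
  rw [eq_empty_iff_forall_notMem]
  intro x hx
  have h1 := lt_of_mem_interior_ball he (interior_mono inter_subset_left hx)
  have h2 : -lor x.1 e' ≤ R' := (interior_subset hx).2
  have h3 := x.2.neg_lor_le he he'
  have h4 := x.2.lor_neg he.1.le he.2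
  have h5 := x.2.lor_neg he'.1.le he'.2
  nlinarith

theorem isPoint_add {e e' : V4} (he : IsFutureNull e) (he' : IsFutureNull e') {α β : ℝ}
    (hα : 0 < α) (hβ : 0 < β) (h : 2 * (α * β) * lor e e' = -1) : IsPoint (α • e + β • e') := by
  constructor
  · simp [he.1, he'.1, lor_comm e' e]
    linarith
  · have := mul_pos hα he.2
    have := mul_pos hβ he'.2
    simp
    linarith

theorem le_of_interior_ball_inter_eq_empty {e e' : V4} (he : IsFutureNull e)
    (he' : IsFutureNull e') {R R' : ℝ} (hR : 0 < R) (hR' : 0 < R') (hD : lor e e' < 0)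
    (h : interior (ball e R ∩ ball e' R') = ∅) : 2 * (R * R') ≤ -lor e e' := by
  by_contra! hlt
  set D := -lor e e' with hDdef
  have hDl : lor e e' = -D := by rw [hDdef]; ring
  have hD0 : 0 < D := by linarith
  set k := √(D / (2 * (R * R'))) with hk
  have hk0 : 0 < k := Real.sqrt_pos.2 (by positivity)
  have hkk : k ^ 2 = D / (2 * (R * R')) := Real.sq_sqrt (by positivity)
  have hk1 : k < 1 := by
    have : k ^ 2 < 1 := by rw [hkk, div_lt_one (by positivity)]; exact hlt
    nlinarith
  -- On the geodesic joining the centres, this point has products `R k` and `R' k` up to sign. The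
  -- factor `k` normalizes it, and `k < 1` means strict overlap.
  have hpt : IsPoint ((R' / D * k) • e + (R / D * k) • e') := by
    refine isPoint_add he he' (by positivity) (by positivity) ?_
    rw [hDl]
    have : 2 * (R' / D * k * (R / D * k)) * -D = -(2 * (R * R') / D) * k ^ 2 := by
      field_simp
    rw [this, hkk]
    field_simp
  have hmem : (⟨_, hpt⟩ : H3) ∈ {x : H3 | -lor x.1 e < R} ∩ {x : H3 | -lor x.1 e' < R'} := by
    constructor
    · change -lor ((R' / D * k) • e + (R / D * k) • e') e < R
      simp only [map_add, map_smul, LinearMap.add_apply, LinearMap.smul_apply, he.1, smul_eq_mul,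
        lor_comm e' e, hDl]
      have : -(R' / D * k * 0 + R / D * k * -D) = R * k := by field_simp; ring
      rw [this]
      nlinarith
    · change -lor ((R' / D * k) • e + (R / D * k) • e') e' < R'
      simp only [map_add, map_smul, LinearMap.add_apply, LinearMap.smul_apply, he'.1, smul_eq_mul,
        hDl]
      have : -(R' / D * k * -D + R / D * k * 0) = R' * k := by field_simp; ring
      rw [this]
      nlinarith
  have hopen : IsOpen ({x : H3 | -lor x.1 e < R} ∩ {x : H3 | -lor x.1 e' < R'}) :=
    (isOpen_lt (continuous_lor_left e).neg continuous_const).inter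
      (isOpen_lt (continuous_lor_left e').neg continuous_const)
  have hsub : {x : H3 | -lor x.1 e < R} ∩ {x : H3 | -lor x.1 e' < R'} ⊆ ball e R ∩ ball e' R' :=
    fun x hx => ⟨le_of_lt (show -lor x.1 e < R from hx.1), le_of_lt (show -lor x.1 e' < R' from hx.2)⟩
  have := interior_maximal hsub hopen hmem
  rw [h] at this
  exact this

theorem exists_lor_eq {e : V4} (he : IsFutureNull e) {R : ℝ} (hR : 0 < R) :
    ∃ x : H3, -lor x.1 e = R := by
  have he0 := he.2
  have h1 := he.1
  rw [lor_apply] at h1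
  set f : V4 := ![e 0, -e 1, -e 2, -e 3] with hf
  have hfn : IsFutureNull f := ⟨by simp [lor_apply, hf]; linarith, by simpa [hf] using he.2⟩
  have hD : lor e f = -(2 * e 0 ^ 2) := by simp [lor_apply, hf]; linarith
  refine ⟨⟨(1 / (2 * R)) • e + (R / (2 * e 0 ^ 2)) • f, isPoint_add he hfn (by positivity)
    (by positivity) ?_⟩, ?_⟩
  · rw [hD]; field_simp
  · simp only [map_add, map_smul, LinearMap.add_apply, LinearMap.smul_apply, he.1, smul_eq_mul,
      lor_comm f e, hD]
    field_simp
    ring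

theorem smul_eq_of_ball_eq {e e' : V4} (he : IsFutureNull e) (he' : IsFutureNull e') {R R' : ℝ}
    (hR : 0 < R) (hR' : 0 < R') (h : ball e R = ball e' R') : R' • e = R • e' := by
  rcases (he.lor_nonpos he').eq_or_lt with h0 | hneg
  · have h1 := he.smul_eq_of_lor_eq_zero he' h0
    have he0 := he.2
    have he0' := he'.2
    have h2 : e' = (e' 0 / e 0) • e := by
      rw [div_eq_inv_mul, mul_smul, h1, smul_smul, inv_mul_cancel₀ he0.ne', one_smul]
    rw [h2, ball_smul _ (div_pos he0' he0)] at h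
    have h3 : R = R' / (e' 0 / e 0) := by
      apply le_antisymm
      · obtain ⟨x, hx⟩ := exists_lor_eq he hR
        have : x ∈ ball e R := hx.le
        rw [h] at this
        exact hx ▸ this
      · obtain ⟨x, hx⟩ := exists_lor_eq he (div_pos hR' (div_pos he0' he0))
        have : x ∈ ball e (R' / (e' 0 / e 0)) := hx.le
        rw [← h] at this
        exact hx ▸ this
    rw [h2, smul_smul, h3, div_mul_cancel₀ _ (div_pos he0' he0).ne']
  · exfalso
    set D := -lor e e' with hDdef
    have hDl : lor e e' = -D := by rw [hDdef]; ring
    have hD0 : 0 < D := by linarith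
    -- Far enough towards the centre `e`: the summand `1 / (2R)` puts the point in the first
    -- horoball, while `R' / D` keeps it out of the second.
    set α := R' / D + 1 / (2 * R) with hα
    have hα0 : 0 < α := by positivity
    have hpt : IsPoint (α • e + (1 / (2 * α * D)) • e') := by
      refine isPoint_add he he' hα0 (by positivity) ?_
      rw [hDl]
      field_simp
    have h1 : (⟨_, hpt⟩ : H3) ∈ ball e R := by
      change -lor (α • e + (1 / (2 * α * D)) • e') e ≤ R
      simp only [map_add, map_smul, LinearMap.add_apply, LinearMap.smul_apply, he.1, smul_eq_mul,
        lor_comm e' e, hDl]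
      have h2 : 1 / (2 * R) ≤ α := by rw [hα]; linarith [div_pos hR' hD0]
      have : -(α * 0 + 1 / (2 * α * D) * -D) = 1 / (2 * α) := by field_simp; ring
      rw [this, div_le_iff₀ (by positivity)]
      rw [div_le_iff₀ (by positivity)] at h2
      linarith
    rw [h] at h1
    have h2 : -lor (α • e + (1 / (2 * α * D)) • e') e' ≤ R' := h1
    simp only [map_add, map_smul, LinearMap.add_apply, LinearMap.smul_apply, he'.1, smul_eq_mul,
      hDl] at h2
    have h3 : R' / D < α := by rw [hα]; linarith [(by positivity : 0 < 1 / (2 * R))]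
    rw [div_lt_iff₀ hD0] at h3
    linarith

/-! ### Permissible radii and non-overlap throughout the orbit -/

/-- The radii of the four horoballs of the cell with respect to the corners of the cell. -/
def cellRadius (s₀ s₁ : ℝ) : Fin 4 → ℝ :=
  ![radius s₀, 2 / 3 * radius s₁, 2 / 3 * radius s₁, 2 / 3 * radius s₁]

theorem Permissible.cellRadius_pos {s₀ s₁ : ℝ} (h : Permissible s₀ s₁) (i : Fin 4) : 0 < cellRadius s₀ s₁ i := by
  have h0 := radius_pos h.1
  have h1 := radius_pos h.2.1
  fin_cases i <;> simp [cellRadius, h0, h1]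

theorem Permissible.cellHoroball_eq {s₀ s₁ : ℝ} (h : Permissible s₀ s₁) (i : Fin 4) :
    cellHoroball s₀ s₁ i = ball (corner i) (cellRadius s₀ s₁ i) := by
  have hn : ∀ i, IsFutureNull (vertexE i) := fun i => by
    rw [vertexE_eq]
    refine (isFutureNull_corner i).smul ?_
    fin_cases i <;> simp
  have h32 : ∀ (k : Fin 4), vertexE k = (3 / 2 : ℝ) • corner k →
      horoball (vertexE k) s₁ = ball (corner k) (2 / 3 * radius s₁) := fun k hk => by
    rw [horoball_eq_ball (hn k) h.2.1, hk, ball_smul _ (by norm_num)]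
    congr 1
    ring
  fin_cases i
  · change horoball (vertexE 0) s₀ = ball (corner 0) (radius s₀)
    rw [horoball_eq_ball (hn 0) h.1, vertexE_eq]
    congr 1
    simp
  · exact h32 1 (vertexE_eq 1)
  · exact h32 2 (vertexE_eq 2)
  · exact h32 3 (vertexE_eq 3)

theorem Permissible.cellRadius_mul_le {s₀ s₁ : ℝ} (h : Permissible s₀ s₁) {i j : Fin 4} (hij : i ≠ j) :
    cellRadius s₀ s₁ i * cellRadius s₀ s₁ j ≤ 1 / 3 := by
  have h1 := h.2.2.1 i j hij
  rw [h.cellHoroball_eq, h.cellHoroball_eq] at h1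
  have h2 := le_of_interior_ball_inter_eq_empty (isFutureNull_corner i) (isFutureNull_corner j)
    (h.cellRadius_pos i) (h.cellRadius_pos j) (by rw [lor_corner_ne hij]; norm_num) h1
  rw [lor_corner_ne hij] at h2
  linarith

/-- Test the wall condition where the geodesic from the corner to its mirror image in the opposite
facet meets the horosphere. The coordinate there is `1 / (2R) - R / 2`. -/
theorem Permissible.cellRadius_le_one {s₀ s₁ : ℝ} (h : Permissible s₀ s₁) (i : Fin 4) : cellRadius s₀ s₁ i ≤ 1 := by
  by_contra! hlt
  have h1 := h.2.2.2 i
  rw [h.cellHoroball_eq] at h1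
  set R := cellRadius s₀ s₁ i with hR
  have hR0 : 0 < R := h.cellRadius_pos i
  have he := isFutureNull_corner i
  have he' := he.map (wall i)
  have hc' : ∀ k, coord ((wall i).1 (corner i)) k = if k = i then -1 else 1 := fun k => by
    rw [coord_wall]
    split_ifs with hk <;> simp [hk]
  have hD : lor (corner i) ((wall i).1 (corner i)) = -2 := by
    rw [lor_comm, lor_corner]
    simp only [hc', Fin.sum_univ_four]
    fin_cases i <;> simp <;> norm_num
  have hpt : IsPoint ((1 / (2 * R)) • corner i + (R / 2) • (wall i).1 (corner i)) := by
    refine isPoint_add he he' (by positivity) (by positivity) ?_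
    rw [hD]; field_simp
  have h2 := h1 ⟨_, hpt⟩ (by
    change -lor ((1 / (2 * R)) • corner i + (R / 2) • (wall i).1 (corner i)) (corner i) ≤ R
    simp only [map_add, map_smul, LinearMap.add_apply, LinearMap.smul_apply, he.1, smul_eq_mul,
      lor_comm _ (corner i), hD]
    linarith)
  rw [lor_pole] at h2
  have h3 : 0 ≤ coord ((1 / (2 * R)) • corner i + (R / 2) • (wall i).1 (corner i)) i := by
    refine nonneg_of_mul_nonneg_right h2 ?_
    fin_cases i <;> simp
  rw [map_add, map_smul, map_smul] at h3
  simp only [Pi.add_apply, Pi.smul_apply, hc', coord_corner, Pi.single_eq_same, if_true,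
    smul_eq_mul] at h3
  have h4 : 1 / (2 * R) < 1 / 2 := by
    rw [div_lt_div_iff₀ (by positivity) (by norm_num)]; linarith
  linarith

/-- Both bounds of `map_corner` are used exactly. For `i ≠ j`, radius product at most 1/3 matches an
integer at least 1; for `i = j`, radius at most 1 matches an integer at least 3. -/
theorem Permissible.interior_inter_eq_empty {s₀ s₁ : ℝ} (h : Permissible s₀ s₁) {g : isomGroup} (hg : g ∈ coxeterT) (i j : Fin 4)
    (hne : ball (corner i) (cellRadius s₀ s₁ i) ≠ ball (g.1 (corner j)) (cellRadius s₀ s₁ j)) :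
    interior (ball (corner i) (cellRadius s₀ s₁ i) ∩
      ball (g.1 (corner j)) (cellRadius s₀ s₁ j)) = ∅ := by
  refine interior_ball_inter_eq_empty (isFutureNull_corner i) ((isFutureNull_corner j).map g)
    (h.cellRadius_pos i) ?_
  obtain ⟨u, hu, rfl | ⟨h1, h3⟩⟩ := map_corner hg j
  · rw [← corner_eq_intVec] at hu
    rw [hu] at hne ⊢
    have hij : i ≠ j := by rintro rfl; exact hne rfl
    rw [lor_corner_ne hij]
    linarith [h.cellRadius_mul_le hij]
  · rw [hu, lor_comm, lor_intVec_corner]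
    by_cases hij : i = j
    · subst hij
      have h4 : (3 : ℝ) ≤ ((∑ k, u k - u i : ℤ) : ℝ) := by exact_mod_cast h3
      have h5 := h.cellRadius_pos i
      have h6 := h.cellRadius_le_one i
      nlinarith
    · have h4 : (1 : ℝ) ≤ ((∑ k, u k - u i : ℤ) : ℝ) := by exact_mod_cast h1 i
      linarith [h.cellRadius_mul_le hij]

theorem Permissible.mem_packing {s₀ s₁ : ℝ} (h : Permissible s₀ s₁) {B : Set H3} : B ∈ packing s₀ s₁ ↔
    ∃ g ∈ coxeterT, ∃ i, B = ball (g.1 (corner i)) (cellRadius s₀ s₁ i) := by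
  simp only [packing, mem_ofPred_eq, h.cellHoroball_eq, move_ball]

theorem move_one (A : Set H3) : move 1 A = A := by rw [move_eq_smul, one_smul]

theorem move_mul (g g' : isomGroup) (A : Set H3) : move (g * g') A = move g (move g' A) := by
  simp only [move_eq_smul, mul_smul]

/-! ### Comparing fundamental domains of subgroups of one countable group -/

/-- Split `G` into left cosets of `H`: the translates of `F` indexed by one coset tile the space. -/
theorem tsum_measure_inter_smul {G α : Type*} [Group G] [MulAction G α] [MeasurableSpace α]
    {μ : Measure α} [Countable G] [MeasurableConstSMul G α] [SMulInvariantMeasure G α μ]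
    {H : Subgroup G} {F : Set α} (hF : IsFundamentalDomain H F μ) (A : Set α) :
    ∑' g : G, μ (A ∩ g • F) = ENat.card (G ⧸ H) * μ A := by
  have h1 : ∀ (q : G ⧸ H) (h : H), μ (A ∩ (q.out * h : G) • F) = μ ((q.out⁻¹ • A) ∩ h • F) := by
    intro q h
    rw [← measure_smul μ (q.out⁻¹) (A ∩ (q.out * h : G) • F), smul_set_inter, smul_smul,
      inv_mul_cancel_left]
    rfl
  have : SMulInvariantMeasure H α μ := ⟨fun c _ hs =>
    SMulInvariantMeasure.measure_preimage_smul (c : G) hs⟩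
  have : MeasurableConstSMul H α := ⟨fun c => measurable_const_smul (c : G)⟩
  have hbij : Function.Bijective fun p : (G ⧸ H) × H => (p.1.out * p.2 : G) := by
    constructor
    · rintro ⟨q, h⟩ ⟨q', h'⟩ heq
      have heq : (q.out * h : G) = q'.out * h' := heq
      have hq : q = q' := by
        have := congrArg (fun g : G => (g : G ⧸ H)) heq
        simpa [QuotientGroup.mk_mul_of_mem _ h.2, QuotientGroup.mk_mul_of_mem _ h'.2] using this
      subst hq
      exact Prod.ext rfl (Subtype.ext (mul_left_cancel heq))
    · intro g
      refine ⟨⟨g, (g : G ⧸ H).out⁻¹ * g, ?_⟩, mul_inv_cancel_left _ _⟩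
      rw [← QuotientGroup.eq, QuotientGroup.out_eq']
  rw [← (Equiv.ofBijective _ hbij).tsum_eq, ENNReal.tsum_prod']
  have h2 : ∀ q : G ⧸ H, ∑' h : H, μ (A ∩ (q.out * h : G) • F) = μ A := by
    intro q
    simp_rw [h1]
    rw [← hF.measure_eq_tsum', measure_smul]
  simp only [Equiv.ofBijective_apply, h2]
  exact ENNReal.tsum_const _

theorem tsum_measure_inter_smul_comm {G α : Type*} [Group G] [MulAction G α] [MeasurableSpace α]
    {μ : Measure α} [MeasurableConstSMul G α] [SMulInvariantMeasure G α μ]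
    (A B : Set α) : ∑' g : G, μ (A ∩ g • B) = ∑' g : G, μ (B ∩ g • A) := by
  rw [← (Equiv.inv G).tsum_eq]
  refine tsum_congr fun g => ?_
  rw [← measure_smul μ g, smul_set_inter, smul_smul, Equiv.inv_apply, mul_inv_cancel, one_smul,
    inter_comm]

/-- Count `∑ μ(U ∩ F' ∩ g F)` over `G` in two ways, moving `g` across by invariance of `U` and `μ`.
-/
theorem card_mul_measure_inter {G α : Type*} [Group G] [MulAction G α] [MeasurableSpace α]
    {μ : Measure α} [Countable G] [MeasurableConstSMul G α] [SMulInvariantMeasure G α μ]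
    {H H' : Subgroup G} {F F' : Set α} (hF : IsFundamentalDomain H F μ)
    (hF' : IsFundamentalDomain H' F' μ) {U : Set α} (hU : ∀ g : G, g • U = U) :
    ENat.card (G ⧸ H) * μ (U ∩ F') = ENat.card (G ⧸ H') * μ (U ∩ F) := by
  rw [← tsum_measure_inter_smul hF, ← tsum_measure_inter_smul hF',
    ← (Equiv.inv G).tsum_eq fun g => μ (U ∩ F ∩ g • F')]
  refine tsum_congr fun g => ?_
  rw [← measure_smul μ g (U ∩ F ∩ (Equiv.inv G) g • F')]
  simp only [smul_set_inter, smul_smul, Equiv.inv_apply, mul_inv_cancel, one_smul, hU]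
  rw [inter_right_comm]

/-- The translates of `K` cover each point at most `n` times, so their total measure inside `F` is
at most `n * μ F`. That total equals the index times `μ K`. -/
theorem card_quotient_ne_top {G α : Type*} [Group G] [MulAction G α] [MeasurableSpace α]
    {μ : Measure α} [Countable G] [MeasurableConstSMul G α] [SMulInvariantMeasure G α μ]
    {H : Subgroup G} {F K : Set α} (hF : IsFundamentalDomain H F μ) (hFt : μ F ≠ ∞)
    (hK : MeasurableSet K) (hK0 : μ K ≠ 0) (hfin : {g : G | (K ∩ g • K).Nonempty}.Finite) :
    (ENat.card (G ⧸ H) : ℝ≥0∞) ≠ ∞ := by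
  set n := hfin.toFinset.card
  have hcount : ∀ x, ∑' g : G, (g • K).indicator (fun _ => (1 : ℝ≥0∞)) x ≤ n := by
    classical
    intro x
    by_cases hx : ∃ g₀ : G, x ∈ g₀ • K
    · obtain ⟨g₀, y, hy, rfl⟩ := hx
      have hsupp : ∀ g ∉ hfin.toFinset.image (g₀ * ·),
          (g • K).indicator (fun _ => (1 : ℝ≥0∞)) (g₀ • y) = 0 := by
        intro g hg
        refine indicator_of_notMem (fun hmem => hg ?_) _
        refine Finset.mem_image.2 ⟨g₀⁻¹ * g, ?_, mul_inv_cancel_left _ _⟩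
        rw [Set.Finite.mem_toFinset]
        refine ⟨y, hy, ?_⟩
        rw [mul_smul, mem_inv_smul_set_iff]
        exact hmem
      rw [tsum_eq_sum hsupp]
      refine (Finset.sum_le_card_nsmul _ _ 1 fun g _ => by
        rw [indicator_apply]; split_ifs <;> simp).trans ?_
      rw [nsmul_eq_mul, mul_one]
      exact_mod_cast Finset.card_image_le
    · push Not at hx
      have : ∀ g : G, (g • K).indicator (fun _ => (1 : ℝ≥0∞)) x = 0 := fun g =>
        indicator_of_notMem (hx g) _
      simp [this]
  have hle : ENat.card (G ⧸ H) * μ K ≤ n * μ F := by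
    rw [← tsum_measure_inter_smul hF, tsum_measure_inter_smul_comm]
    calc ∑' g : G, μ (F ∩ g • K)
        = ∑' g : G, ∫⁻ x in F, (g • K).indicator (fun _ => (1 : ℝ≥0∞)) x ∂μ := by
          refine tsum_congr fun g => ?_
          rw [lintegral_indicator_const (hK.const_smul g), one_mul,
            Measure.restrict_apply (hK.const_smul g), inter_comm]
      _ = ∫⁻ x in F, ∑' g : G, (g • K).indicator (fun _ => (1 : ℝ≥0∞)) x ∂μ :=
          (lintegral_tsum fun g =>
            (measurable_const.indicator (hK.const_smul g)).aemeasurable).symm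
      _ ≤ ∫⁻ _ in F, (n : ℝ≥0∞) ∂μ := lintegral_mono hcount
      _ = n * μ F := by rw [setLIntegral_const]
  intro htop
  rw [htop, ENNReal.top_mul hK0, top_le_iff] at hle
  exact ENNReal.mul_ne_top (ENNReal.natCast_ne_top n) hFt hle

theorem measure_div_eq_of_isFundamentalDomain {G α : Type*} [Group G] [MulAction G α]
    [MeasurableSpace α] {μ : Measure α} [Countable G] [MeasurableConstSMul G α]
    [SMulInvariantMeasure G α μ] {H H' : Subgroup G} {F F' K U : Set α}
    (hF : IsFundamentalDomain H F μ) (hF' : IsFundamentalDomain H' F' μ)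
    (hFt : μ F ≠ ∞) (hFt' : μ F' ≠ ∞)
    (hK : MeasurableSet K) (hK0 : μ K ≠ 0) (hfin : {g : G | (K ∩ g • K).Nonempty}.Finite)
    (hU : ∀ g : G, g • U = U) : μ (U ∩ F') / μ F' = μ (U ∩ F) / μ F := by
  have h1 := card_mul_measure_inter hF hF' hU
  have h2 := card_mul_measure_inter hF hF' (U := univ) fun g => smul_set_univ
  rw [univ_inter, univ_inter] at h2
  have hne : ∀ H : Subgroup G, (ENat.card (G ⧸ H) : ℝ≥0∞) ≠ 0 := fun H => by
    simp
  rw [← ENNReal.mul_div_mul_left _ _ (hne H) (card_quotient_ne_top hF hFt hK hK0 hfin), h1, h2,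
    ENNReal.mul_div_mul_left _ _ (hne H') (card_quotient_ne_top hF' hFt' hK hK0 hfin)]

theorem IsFundamentalDomain.subgroupOf {G α : Type*} [Group G] [MulAction G α]
    [MeasurableSpace α] {μ : Measure α} {Γ S : Subgroup G} (hle : Γ ≤ S) {F : Set α}
    (h : IsFundamentalDomain Γ F μ) : IsFundamentalDomain (Γ.subgroupOf S) F μ where
  nullMeasurableSet := h.nullMeasurableSet
  ae_covers := h.ae_covers.mono fun _ ⟨g, hg⟩ => ⟨⟨⟨g.1, hle g.2⟩, g.2⟩, hg⟩
  aedisjoint a b hab := by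
    refine h.aedisjoint (i := ⟨a.1.1, a.2⟩) (j := ⟨b.1.1, b.2⟩) fun hc => hab ?_
    exact Subtype.ext (Subtype.ext (congrArg (fun x : Γ => (x : G)) hc))

/-! ### The cell as a fundamental domain -/

theorem hypVol_coord_eq_zero (i : Fin 4) : hypVol {x : H3 | coord x.1 i = 0} = 0 := by
  refine hypVol_hyperplane (f := LinearMap.proj i ∘ₗ (coord : V4 →ₗ[ℝ] (Fin 4 → ℝ))) fun h => ?_
  have := LinearMap.congr_fun h (corner i)
  simp at this

theorem hypVol_coord_eq_coord {i j : Fin 4} (hij : i ≠ j) :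
    hypVol {x : H3 | coord x.1 i = coord x.1 j} = 0 := by
  have h := hypVol_hyperplane (f := LinearMap.proj i ∘ₗ (coord : V4 →ₗ[ℝ] (Fin 4 → ℝ)) -
    LinearMap.proj j ∘ₗ (coord : V4 →ₗ[ℝ] (Fin 4 → ℝ))) fun h => by
      have : coord (corner i) i - coord (corner i) j = 0 := LinearMap.congr_fun h (corner i)
      simp [hij.symm] at this
  exact (congrArg hypVol (Set.ext fun x => sub_eq_zero.symm)).trans h

theorem smul_mem_cell_iff {g : isomGroup} {x : H3} :
    g • x ∈ cell ↔ ∀ i, 0 ≤ coord (g.1 x.1) i := by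
  rw [cell_eq]; rfl

theorem countable_coxeterT : Countable coxeterT := by
  have h : ∀ g : coxeterT, ∀ j, ∃ u : Fin 4 → ℤ, g.1.1 (corner j) = intVec u := fun g j => by
    obtain ⟨u, hu, -⟩ := map_corner g.2 j
    exact ⟨u, hu⟩
  choose u hu using h
  refine Function.Injective.countable (f := u) fun g g' hgg => ?_
  refine Subtype.ext (isom_ext fun j => ?_)
  rw [hu, hu, hgg]

theorem isFundamentalDomain_cell : IsFundamentalDomain coxeterT cell hypVol := by
  refine IsFundamentalDomain.mk'' measurableSet_cell.nullMeasurableSet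
    (Filter.Eventually.of_forall fun x => ?_) (fun g hg => ?_)
    fun g => (measurePreserving_smul g hypVol).quasiMeasurePreserving
  · obtain ⟨g, hg, h⟩ := exists_map_mem_cell x
    exact ⟨⟨g, hg⟩, smul_mem_cell_iff.2 h⟩
  · refine measure_mono_null (t := ⋃ i, {x : H3 | coord x.1 i = 0}) ?_
      (measure_iUnion_null hypVol_coord_eq_zero)
    rintro x ⟨hx1, hx2⟩
    rw [mem_smul_set_iff_inv_smul_mem] at hx1
    by_contra hc
    simp only [mem_iUnion, mem_ofPred_eq, not_exists] at hc
    rw [cell_eq] at hx2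
    have h1 : (g.1)⁻¹ = 1 := eq_one_of_map_mem_cell (inv_mem g.2)
      (fun i => lt_of_le_of_ne (hx2 i) (Ne.symm (hc i))) (smul_mem_cell_iff.1 hx1)
    exact hg (Subtype.ext (inv_eq_one.1 h1))

/-! ### Symmetries of the cell fixing `E₀`, and the orthoscheme -/

/-- The isometry which permutes the coordinates. -/
def permIsom (τ : Equiv.Perm (Fin 4)) (hτ : τ 0 = 0) : isomGroup := by
  refine ⟨(coord.trans (LinearEquiv.funCongrLeft ℝ ℝ τ)).trans coord.symm, ?_⟩
  have hco : ∀ v i, coord ((coord.trans (LinearEquiv.funCongrLeft ℝ ℝ τ)).trans coord.symm v) i =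
      coord v (τ i) := fun v i => by simp [LinearEquiv.funCongrLeft]
  have hl : ∀ x y, lor ((coord.trans (LinearEquiv.funCongrLeft ℝ ℝ τ)).trans coord.symm x)
      ((coord.trans (LinearEquiv.funCongrLeft ℝ ℝ τ)).trans coord.symm y) = lor x y := fun x y => by
    rw [lor_eq_coord, lor_eq_coord x]
    simp only [hco]
    rw [Equiv.sum_comp τ fun i => coord x i * coord y i, Equiv.sum_comp τ fun i => coord x i,
      Equiv.sum_comp τ fun i => coord y i]
  refine ⟨hl, fun x => ?_⟩
  have h0 : ∀ v, v 0 = 2 / 3 * ∑ i, coord v i + 1 / 3 * coord v 0 := fun v => by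
    rw [apply_zero_eq_coord v, Fin.sum_univ_four]; ring
  have e0 : ((coord.trans (LinearEquiv.funCongrLeft ℝ ℝ τ)).trans coord.symm x) 0 = x 0 :=
    (h0 _).trans (by simp only [hco, hτ]; rw [Equiv.sum_comp τ fun i => coord x i, ← h0 x])
  rw [IsPoint, IsPoint, hl, e0]

theorem coord_permIsom (τ : Equiv.Perm (Fin 4)) (hτ : τ 0 = 0) (v : V4) (i : Fin 4) :
    coord ((permIsom τ hτ).1 v) i = coord v (τ i) := by
  simp [permIsom, LinearEquiv.funCongrLeft]

/-- The symmetries of the cell which fix the vertex `E₀`. -/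
def stab : Subgroup isomGroup where
  carrier := {g | ∃ τ : Equiv.Perm (Fin 4), τ 0 = 0 ∧ ∀ v i, coord (g.1 v) i = coord v (τ i)}
  one_mem' := ⟨1, rfl, fun _ _ => rfl⟩
  mul_mem' := by
    rintro a b ⟨τ, hτ, h⟩ ⟨τ', hτ', h'⟩
    refine ⟨τ' * τ, by simp [hτ, hτ'], fun v i => ?_⟩
    exact (h (b.1 v) i).trans (h' v (τ i))
  inv_mem' := by
    rintro a ⟨τ, hτ, h⟩
    refine ⟨τ⁻¹, by rw [Equiv.Perm.inv_eq_iff_eq]; exact hτ.symm, fun v i => ?_⟩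
    have := h ((a⁻¹).1 v) (τ⁻¹ i)
    rw [map_map_inv] at this
    simpa using this.symm

theorem finite_stab : Finite stab := by
  have h : ∀ g : stab, ∃ τ : Equiv.Perm (Fin 4), ∀ v i, coord (g.1.1 v) i = coord v (τ i) :=
    fun g => let ⟨τ, _, h⟩ := g.2; ⟨τ, h⟩
  choose τ hτ using h
  refine Finite.of_injective τ fun g g' hgg => ?_
  refine Subtype.ext (isom_ext fun j => coord.injective (funext fun i => ?_))
  rw [hτ, hτ, hgg]

/-- The wedge cut off by the planes of symmetry of the cell through `E₀`. -/
def wedge : Set H3 := {x | coord x.1 2 ≤ coord x.1 1 ∧ coord x.1 3 ≤ coord x.1 2}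

theorem measurableSet_wedge : MeasurableSet wedge := by
  have h : ∀ i, Continuous fun x : H3 => coord x.1 i := fun i =>
    (continuous_coord_apply i).comp continuous_subtype_val
  exact (isClosed_le (h 2) (h 1)).measurableSet.inter (isClosed_le (h 3) (h 2)).measurableSet

theorem cell_inter_wedge : cell ∩ wedge = orthoscheme := by
  rw [cell_eq, orthoscheme_eq]; rfl

theorem exists_perm_sorted (f : Fin 4 → ℝ) :
    ∃ τ : Equiv.Perm (Fin 4), τ 0 = 0 ∧ f (τ 2) ≤ f (τ 1) ∧ f (τ 3) ≤ f (τ 2) := by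
  rcases le_total (f 1) (f 2) with h12 | h12 <;> rcases le_total (f 2) (f 3) with h23 | h23 <;>
    rcases le_total (f 1) (f 3) with h13 | h13
  · exact ⟨Equiv.swap 1 3, rfl, h23, h12⟩
  · exact ⟨Equiv.swap 1 3, rfl, h23, h12⟩
  · exact ⟨Equiv.swap 1 2 * Equiv.swap 2 3, rfl, h23, h13⟩
  · exact ⟨Equiv.swap 1 2, rfl, h12, h13⟩
  · exact ⟨Equiv.swap 1 3 * Equiv.swap 2 3, rfl, h13, h12⟩
  · exact ⟨Equiv.swap 2 3, rfl, h13, h23⟩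
  · exact ⟨1, rfl, h12, h23⟩
  · exact ⟨1, rfl, h12, h23⟩

theorem isFundamentalDomain_wedge : IsFundamentalDomain stab wedge hypVol := by
  refine IsFundamentalDomain.mk'' measurableSet_wedge.nullMeasurableSet
    (Filter.Eventually.of_forall fun x => ?_) (fun g hg => ?_)
    fun g => (measurePreserving_smul g hypVol).quasiMeasurePreserving
  · obtain ⟨τ, hτ, h⟩ := exists_perm_sorted (coord x.1)
    refine ⟨⟨permIsom τ hτ, τ, hτ, coord_permIsom τ hτ⟩, ?_⟩
    change coord ((permIsom τ hτ).1 x.1) 2 ≤ coord ((permIsom τ hτ).1 x.1) 1 ∧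
      coord ((permIsom τ hτ).1 x.1) 3 ≤ coord ((permIsom τ hτ).1 x.1) 2
    simpa only [coord_permIsom] using h
  · refine measure_mono_null
      (t := {x : H3 | coord x.1 1 = coord x.1 2} ∪ {x : H3 | coord x.1 2 = coord x.1 3}) ?_
      (measure_union_null (hypVol_coord_eq_coord (by decide)) (hypVol_coord_eq_coord (by decide)))
    rintro x ⟨hx1, hx2⟩
    rw [mem_smul_set_iff_inv_smul_mem] at hx1
    obtain ⟨τ, hτ, h⟩ := inv_mem g.2
    have hx1' : coord (((g.1)⁻¹).1 x.1) 2 ≤ coord (((g.1)⁻¹).1 x.1) 1 ∧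
      coord (((g.1)⁻¹).1 x.1) 3 ≤ coord (((g.1)⁻¹).1 x.1) 2 := hx1
    rw [h, h, h] at hx1'
    by_contra hc
    simp only [mem_union, mem_ofPred_eq, not_or] at hc
    have h12 : coord x.1 2 < coord x.1 1 := lt_of_le_of_ne hx2.1 (Ne.symm hc.1)
    have h23 : coord x.1 3 < coord x.1 2 := lt_of_le_of_ne hx2.2 (Ne.symm hc.2)
    have hanti : ∀ a b : Fin 4, a ≠ 0 → a < b → coord x.1 b < coord x.1 a := by
      intro a b ha hab
      fin_cases a <;> fin_cases b <;> simp at ha hab ⊢ <;> linarith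
    -- A nontrivial permutation of 1, 2, 3 has a descent at adjacent places, which contradicts
    -- strictly decreasing coordinates.
    have hperm : ∀ τ : Equiv.Perm (Fin 4), τ 0 = 0 →
        τ = 1 ∨ (τ 2 ≠ 0 ∧ τ 2 < τ 1) ∨ (τ 3 ≠ 0 ∧ τ 3 < τ 2) := by decide
    rcases hperm τ hτ with rfl | ⟨h0, hlt⟩ | ⟨h0, hlt⟩
    · refine hg (inv_eq_one.1 (Subtype.ext (isom_ext fun j => coord.injective (funext fun i => ?_))))
      exact h _ _
    · exact absurd hx1'.1 (not_le.2 (hanti _ _ h0 hlt))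
    · exact absurd hx1'.2 (not_le.2 (hanti _ _ h0 hlt))

theorem hypVol_eq_card_stab_mul {A : Set H3} (hA : ∀ g ∈ stab, ∀ x ∈ A, g • x ∈ A) :
    hypVol A = Nat.card stab • hypVol (A ∩ wedge) := by
  have := finite_stab
  refine isFundamentalDomain_wedge.measure_eq_card_smul_of_smul_ae_eq_self A fun g => ?_
  refine Filter.EventuallyEq.of_eq (Subset.antisymm ?_ fun x hx => ?_)
  · rintro _ ⟨x, hx, rfl⟩
    exact hA g.1 g.2 x hx
  · rw [mem_smul_set_iff_inv_smul_mem]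
    exact hA _ (inv_mem g.2) x hx

theorem smul_mem_cell_of_mem_stab {g : isomGroup} (hg : g ∈ stab) {x : H3} (hx : x ∈ cell) :
    g • x ∈ cell := by
  obtain ⟨τ, -, h⟩ := hg
  rw [cell_eq] at hx ⊢
  intro i
  rw [coe_smul_H3, h]
  exact hx _

theorem mem_ball_corner {x : H3} {i : Fin 4} {R : ℝ} :
    x ∈ ball (corner i) R ↔ 2 / 3 * (∑ k, coord x.1 k - coord x.1 i) ≤ R := by
  change -lor x.1 (corner i) ≤ R ↔ _
  rw [lor_corner, neg_neg]

/-! ### The symmetry group of the packing and the densities -/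

/-- The isometries which permute the members of a collection of sets. -/
def symGroup (P : Set (Set H3)) : Subgroup isomGroup where
  carrier := {g | ∀ B, move g B ∈ P ↔ B ∈ P}
  one_mem' B := by rw [move_one]
  mul_mem' {a b} ha hb B := by rw [move_mul, ha, hb]
  inv_mem' {a} ha B := by rw [← ha, ← move_mul, mul_inv_cancel, move_one]

theorem le_symGroup {P : Set (Set H3)} {Γ : Subgroup isomGroup}
    (h : ∀ g ∈ Γ, ∀ B ∈ P, move g B ∈ P) : Γ ≤ symGroup P := by
  refine fun g hg B => ⟨fun hB => ?_, h g hg B⟩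
  have := h _ (inv_mem hg) _ hB
  rwa [← move_mul, inv_mul_cancel, move_one] at this

theorem smul_sUnion_of_mem_symGroup {P : Set (Set H3)} {g : isomGroup} (hg : g ∈ symGroup P) :
    g • ⋃₀ P = ⋃₀ P := by
  have key : ∀ g ∈ symGroup P, g • ⋃₀ P ⊆ ⋃₀ P := by
    rintro g hg _ ⟨x, ⟨B, hB, hx⟩, rfl⟩
    exact ⟨move g B, (hg B).2 hB, x, hx, rfl⟩
  refine (key g hg).antisymm ?_
  rw [subset_smul_set_iff]
  exact key _ (inv_mem hg)

theorem IsPoint.neg_lor_le_mul {x e : V4} (hx : IsPoint x) (he : IsFutureNull e) :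
    -lor x e ≤ 2 * (x 0 * e 0) := by
  have h1 := hx.1
  have h2 := he.1
  have h0 := mul_pos hx.2 he.2
  rw [lor_apply] at *
  have hcs : (x 1 * e 1 + x 2 * e 2 + x 3 * e 3) ^ 2 ≤
      (x 1 ^ 2 + x 2 ^ 2 + x 3 ^ 2) * (e 1 ^ 2 + e 2 ^ 2 + e 3 ^ 2) := by
    nlinarith [sq_nonneg (x 1 * e 2 - x 2 * e 1), sq_nonneg (x 1 * e 3 - x 3 * e 1),
      sq_nonneg (x 2 * e 3 - x 3 * e 2)]
  have hX : x 1 ^ 2 + x 2 ^ 2 + x 3 ^ 2 = x 0 ^ 2 - 1 := by linarith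
  have hE : e 1 ^ 2 + e 2 ^ 2 + e 3 ^ 2 = e 0 ^ 2 := by linarith
  rw [hX, hE] at hcs
  have := (abs_le.1 (abs_le_of_sq_le_sq (by nlinarith [sq_nonneg (e 0)]) h0.le :
    |x 1 * e 1 + x 2 * e 2 + x 3 * e 3| ≤ x 0 * e 0)).1
  linarith

theorem move_mem_packing {s₀ s₁ : ℝ} {g : isomGroup} (hg : g ∈ coxeterT) {B : Set H3}
    (hB : B ∈ packing s₀ s₁) : move g B ∈ packing s₀ s₁ := by
  obtain ⟨g', hg', i, rfl⟩ := hB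
  exact ⟨g * g', mul_mem hg hg', i, (move_mul _ _ _).symm⟩

namespace Permissible

theorem isHoroballPacking {s₀ s₁ : ℝ} (h : Permissible s₀ s₁) :
    IsHoroballPacking (packing s₀ s₁) := by
  refine ⟨?_, fun B hB => ?_, fun B hB B' hB' hne => ?_⟩
  · have := countable_coxeterT
    refine (countable_range fun p : coxeterT × Fin 4 => move p.1.1 (cellHoroball s₀ s₁ p.2)).mono ?_
    rintro B ⟨g, hg, i, rfl⟩
    exact ⟨(⟨g, hg⟩, i), rfl⟩
  · obtain ⟨g, -, i, rfl⟩ := h.mem_packing.1 hB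
    exact isHoroball_ball ((isFutureNull_corner i).map g) (h.cellRadius_pos i)
  · obtain ⟨g, hg, i, rfl⟩ := h.mem_packing.1 hB
    obtain ⟨g', hg', j, rfl⟩ := h.mem_packing.1 hB'
    have e1 : ball (g'.1 (corner j)) (cellRadius s₀ s₁ j) =
        g • ball ((g⁻¹ * g').1 (corner j)) (cellRadius s₀ s₁ j) := by
      rw [← move_eq_smul, move_ball]
      congr 1
      exact (map_map_inv g _).symm
    rw [e1, ← move_ball, move_eq_smul] at hne ⊢
    rw [← smul_set_inter, interior_smul, h.interior_inter_eq_empty (mul_mem (inv_mem hg) hg'),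
      smul_set_empty]
    exact fun hc => hne (by rw [hc])

/-- A horoball determines its null vector once the radius is fixed. So a symmetry, even one outside
the Coxeter group, sends corners to integer vectors up to one of finitely many ratios of radii. -/
theorem map_corner_of_mem_symGroup {s₀ s₁ : ℝ} (h : Permissible s₀ s₁) {s : isomGroup}
    (hs : s ∈ symGroup (packing s₀ s₁)) (j : Fin 4) : ∃ p : Fin 4 × (Fin 4 → ℤ),
      s.1 (corner j) = (cellRadius s₀ s₁ j / cellRadius s₀ s₁ p.1) • intVec p.2 := by
  have h1 : ball (corner j) (cellRadius s₀ s₁ j) ∈ packing s₀ s₁ :=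
    h.mem_packing.2 ⟨1, one_mem _, j, rfl⟩
  have h2 := (hs _).2 h1
  rw [move_ball] at h2
  obtain ⟨g, hg, i, hgi⟩ := h.mem_packing.1 h2
  have h3 := smul_eq_of_ball_eq ((isFutureNull_corner j).map s) ((isFutureNull_corner i).map g)
    (h.cellRadius_pos j) (h.cellRadius_pos i) hgi
  obtain ⟨u, hu, -⟩ := map_corner hg i
  refine ⟨(i, u), ?_⟩
  rw [← hu, div_eq_inv_mul, mul_smul, ← h3, smul_smul, inv_mul_cancel₀ (h.cellRadius_pos i).ne',
    one_smul]

/-- A symmetry is determined by discrete data, the images of the four corners. If it moves a point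
of `core` into `core`, these images have bounded time coordinate, which leaves finitely many integer
vectors. -/
theorem countable_symGroup_and_finite {s₀ s₁ : ℝ} (h : Permissible s₀ s₁) :
    Countable (symGroup (packing s₀ s₁)) ∧
      {g : symGroup (packing s₀ s₁) | (core ∩ g • core).Nonempty}.Finite := by
  choose p hp using fun (s : symGroup (packing s₀ s₁)) (j : Fin 4) =>
    h.map_corner_of_mem_symGroup s.2 j
  have hinj : Function.Injective p := fun s s' hss => by
    refine Subtype.ext (isom_ext fun j => ?_)
    rw [hp, hp, hss]
  refine ⟨hinj.countable, ?_⟩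
  set r := cellRadius s₀ s₁ with hr
  -- The constant 16 is four factors 2: one from each of `apply_zero_le` and `neg_lor_le_mul`, and
  -- one from each of the two points in `core`.
  set S : Fin 4 → Set (Fin 4 × (Fin 4 → ℤ)) := fun j => ⋃ i, Prod.mk i ''
    {z | lor (intVec z) (intVec z) ≤ 0 ∧ 0 ≤ intVec z 0 ∧
      intVec z 0 ≤ r i / r j * (16 * corner j 0)}
  have hS : ∀ j, (S j).Finite := fun j =>
    Set.finite_iUnion fun i => (finite_intVec_le _).image _
  refine ((Set.Finite.pi' hS).preimage hinj.injOn).subset ?_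
  rintro g ⟨x, hx, y, hy, rfl⟩ j
  have hx : (g.1.1 y.1) 0 < 2 := hx
  have hy : y.1 0 < 2 := hy
  refine mem_iUnion.2 ⟨(p g j).1, (p g j).2, ?_, rfl⟩
  have hrj := h.cellRadius_pos j
  have hri := h.cellRadius_pos (p g j).1
  have hv : intVec (p g j).2 = (r (p g j).1 / r j) • g.1.1 (corner j) := by
    have := hrj.ne'
    have := hri.ne'
    rw [hp, smul_smul, hr]
    conv_lhs => rw [← one_smul ℝ (intVec _)]
    congr 1
    field_simp
  have hn := (isFutureNull_corner j).map g.1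
  have hn' : IsFutureNull (intVec (p g j).2) := by
    rw [hv]; exact hn.smul (div_pos hri hrj)
  refine ⟨hn'.1.le, hn'.2.le, ?_⟩
  rw [hv]
  refine mul_le_mul_of_nonneg_left ?_ (div_pos hri hrj).le
  have hg : IsPoint (g.1.1 y.1) := (g.1.2.2 _).2 y.2
  have h1 := hg.apply_zero_le hn.1.le hn.2.le
  rw [lor_map] at h1
  have h2 := y.2.neg_lor_le_mul (isFutureNull_corner j)
  have hc := (isFutureNull_corner j).2
  have hy0 := y.2.2
  have h3 : -lor y.1 (corner j) ≤ 4 * corner j 0 := by nlinarith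
  have h4 : 0 < -lor y.1 (corner j) := by
    linarith [y.2.lor_neg (lor_corner_self j).le hc]
  have := hg.2
  nlinarith

theorem sUnion_packing_inter_cell {s₀ s₁ : ℝ} (h : Permissible s₀ s₁) :
    ⋃₀ packing s₀ s₁ ∩ cell = ⋃ i, cellHoroball s₀ s₁ i ∩ cell := by
  ext x
  simp only [mem_inter_iff, mem_iUnion]
  constructor
  · rintro ⟨⟨B, hB, hx⟩, hc⟩
    obtain ⟨g, hg, j, rfl⟩ := h.mem_packing.1 hB
    refine ⟨j, ?_, hc⟩
    rw [h.cellHoroball_eq]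
    have hc' := hc
    rw [cell_eq] at hc'
    have h1 := (lor_map_corner_le hg hc' j).1
    have h2 : -lor x.1 (g.1 (corner j)) ≤ cellRadius s₀ s₁ j := hx
    change -lor x.1 (corner j) ≤ _
    linarith
  · rintro ⟨i, hx, hc⟩
    exact ⟨⟨_, ⟨1, one_mem _, i, (move_one _).symm⟩, hx⟩, hc⟩

/-- A common point forces equality in both horoball inequalities, so the intersection lies in a
hyperplane. -/
theorem aedisjoint_cellHoroball {s₀ s₁ : ℝ} (h : Permissible s₀ s₁) {i j : Fin 4} (hij : i ≠ j) :
    AEDisjoint hypVol (cellHoroball s₀ s₁ i ∩ cell) (cellHoroball s₀ s₁ j ∩ cell) := by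
  rw [h.cellHoroball_eq, h.cellHoroball_eq]
  have hri := h.cellRadius_pos i
  have hrj := h.cellRadius_pos j
  have hr := h.cellRadius_mul_le hij
  set r := cellRadius s₀ s₁
  refine measure_mono_null ?_ (hypVol_hyperplane
    (f := r j • lor (corner i) - r i • lor (corner j)) fun hc => ?_)
  · rintro x ⟨⟨h1, -⟩, h2, -⟩
    have h1 : -lor x.1 (corner i) ≤ r i := h1
    have h2 : -lor x.1 (corner j) ≤ r j := h2
    have ha := x.2.lor_neg (lor_corner_self i).le (isFutureNull_corner i).2
    have hb := x.2.lor_neg (lor_corner_self j).le (isFutureNull_corner j).2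
    have h3 := x.2.neg_lor_le (isFutureNull_corner i) (isFutureNull_corner j)
    rw [lor_corner_ne hij] at h3
    have e1 : -lor x.1 (corner i) = r i := by
      refine le_antisymm h1 ?_
      by_contra! hlt
      nlinarith
    have e2 : -lor x.1 (corner j) = r j := by
      refine le_antisymm h2 ?_
      by_contra! hlt
      nlinarith
    change r j * lor (corner i) x.1 - r i * lor (corner j) x.1 = 0
    rw [lor_comm (corner i), lor_comm (corner j), ← e1, ← e2]
    ring
  · have h1 : r j * lor (corner i) (corner i) - r i * lor (corner j) (corner i) = 0 :=
      LinearMap.congr_fun hc (corner i)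
    rw [lor_corner_self, lor_corner_ne hij.symm] at h1
    linarith

theorem measurableSet_cellHoroball_inter {s₀ s₁ : ℝ} (h : Permissible s₀ s₁) (i : Fin 4) :
    MeasurableSet (cellHoroball s₀ s₁ i ∩ cell) := by
  rw [h.cellHoroball_eq]
  exact (measurableSet_ball _ _).inter measurableSet_cell

theorem coveredPart_cell {s₀ s₁ : ℝ} (h : Permissible s₀ s₁) :
    coveredPart (packing s₀ s₁) cell = cellDensity s₀ s₁ := by
  rw [coveredPart, cellDensity, h.sUnion_packing_inter_cell, measure_iUnion₀
    (fun i j hij => h.aedisjoint_cellHoroball hij)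
    (fun i => (h.measurableSet_cellHoroball_inter i).nullMeasurableSet), tsum_fintype]

/-- The union of the three pieces is invariant under `stab`. Inside the wedge coordinate 1 is the
largest of the last three, so the horoball at `corner 1` contains the other two pieces there. -/
theorem sum_succ_eq {s₀ s₁ : ℝ} (h : Permissible s₀ s₁) :
    ∑ i : Fin 3, hypVol (cellHoroball s₀ s₁ i.succ ∩ cell) =
      Nat.card stab • hypVol (cellHoroball s₀ s₁ 1 ∩ orthoscheme) := by
  have hr : ∀ i : Fin 3, cellRadius s₀ s₁ i.succ = cellRadius s₀ s₁ 1 := fun i => by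
    fin_cases i <;> rfl
  have hU := measure_iUnion₀ (f := fun i : Fin 3 => cellHoroball s₀ s₁ i.succ ∩ cell)
    (fun i j hij => h.aedisjoint_cellHoroball (by simpa using hij))
    (fun i => (h.measurableSet_cellHoroball_inter i.succ).nullMeasurableSet)
  rw [tsum_fintype] at hU
  rw [← hU, hypVol_eq_card_stab_mul]
  · congr 2
    rw [← cell_inter_wedge]
    ext x
    simp only [mem_inter_iff, mem_iUnion, h.cellHoroball_eq, hr, mem_ball_corner]
    constructor
    · rintro ⟨⟨i, hi, hc⟩, hw⟩
      refine ⟨?_, hc, hw⟩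
      have h1 := hw.1
      have h2 := hw.2
      have : coord x.1 i.succ ≤ coord x.1 1 := by
        fin_cases i
        exacts [le_rfl, h1, h2.trans h1]
      linarith
    · rintro ⟨hi, hc, hw⟩
      exact ⟨⟨0, hi, hc⟩, hw⟩
  · intro g hg x hx
    obtain ⟨i, hi, hc⟩ := mem_iUnion.1 hx
    obtain ⟨τ, hτ, hco⟩ := id hg
    have hne : τ.symm i.succ ≠ 0 := by
      intro h0
      rw [Equiv.symm_apply_eq, hτ] at h0
      exact Fin.succ_ne_zero i h0
    obtain ⟨j, hj⟩ := Fin.exists_succ_eq.2 hne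
    refine mem_iUnion.2 ⟨j, ?_, smul_mem_cell_of_mem_stab hg hc⟩
    rw [h.cellHoroball_eq, hr, mem_ball_corner] at hi ⊢
    simp only [coe_smul_H3, hco]
    rw [Equiv.sum_comp τ fun i => coord x.1 i, hj, Equiv.apply_symm_apply]
    exact hi

theorem cellDensity_eq {s₀ s₁ : ℝ} (h : Permissible s₀ s₁) :
    cellDensity s₀ s₁ = orthoschemeDensity s₀ s₁ := by
  have hcell : hypVol cell = Nat.card stab • hypVol orthoscheme := by
    rw [hypVol_eq_card_stab_mul fun g hg x hx => smul_mem_cell_of_mem_stab hg hx,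
      cell_inter_wedge]
  have h0 : hypVol (cellHoroball s₀ s₁ 0 ∩ cell) =
      Nat.card stab • hypVol (cellHoroball s₀ s₁ 0 ∩ orthoscheme) := by
    rw [hypVol_eq_card_stab_mul, inter_assoc, cell_inter_wedge]
    rintro g hg x ⟨hx, hc⟩
    refine ⟨?_, smul_mem_cell_of_mem_stab hg hc⟩
    obtain ⟨τ, hτ, hco⟩ := hg
    rw [h.cellHoroball_eq, mem_ball_corner] at hx ⊢
    simp only [coe_smul_H3, hco, hτ]
    rwa [Equiv.sum_comp τ fun i => coord x.1 i]
  have := finite_stab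
  have hcard : (Nat.card stab : ℝ≥0∞) ≠ 0 := by exact_mod_cast Nat.card_pos.ne'
  rw [cellDensity, orthoschemeDensity, Fin.sum_univ_succ, h.sum_succ_eq, h0, hcell, ← smul_add,
    nsmul_eq_mul, nsmul_eq_mul,
    ENNReal.mul_div_mul_left _ _ hcard (ENNReal.natCast_ne_top _)]

theorem isPeriod {s₀ s₁ : ℝ} : IsPeriod (packing s₀ s₁) coxeterT cell :=
  ⟨Set.countable_coe_iff.1 countable_coxeterT, fun _ hg _ hB => move_mem_packing hg hB,
    isFundamentalDomain_cell, hypVol_cell_pos, hypVol_cell_lt_top⟩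

theorem coveredPart_move_cell {s₀ s₁ : ℝ} {g : isomGroup} (hg : g ∈ coxeterT) :
    coveredPart (packing s₀ s₁) (move g cell) = coveredPart (packing s₀ s₁) cell := by
  have h1 : ⋃₀ packing s₀ s₁ ∩ move g cell = move g (⋃₀ packing s₀ s₁ ∩ cell) := by
    rw [move_eq_smul, move_eq_smul, smul_set_inter,
      smul_sUnion_of_mem_symGroup (le_symGroup (fun _ hg _ hB => move_mem_packing hg hB) hg)]
  rw [coveredPart, h1, hypVol_move, hypVol_move, coveredPart]

theorem coveredPart_eq_of_isPeriod {s₀ s₁ : ℝ} (h : Permissible s₀ s₁) {Γ : Subgroup isomGroup}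
    {F : Set H3} (hF : IsPeriod (packing s₀ s₁) Γ F) :
    coveredPart (packing s₀ s₁) F = coveredPart (packing s₀ s₁) cell := by
  obtain ⟨-, hΓ, hfd, -, hlt⟩ := hF
  obtain ⟨hcount, hfin⟩ := h.countable_symGroup_and_finite
  exact measure_div_eq_of_isFundamentalDomain
    (IsFundamentalDomain.subgroupOf (le_symGroup fun _ hg _ hB => move_mem_packing hg hB)
      isFundamentalDomain_cell)
    (IsFundamentalDomain.subgroupOf (le_symGroup hΓ) hfd) hypVol_cell_lt_top.ne hlt.ne
    measurableSet_core hypVol_core_pos.ne' hfin fun g => smul_sUnion_of_mem_symGroup g.2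

end Permissible

end Honeycomb336

end

theorem mainTheorem1 (s₀ s₁ : ℝ) (h : Permissible s₀ s₁) :
    (0 < hypVol orthoscheme ∧ hypVol orthoscheme < ∞) ∧
    (0 < hypVol cell ∧ hypVol cell < ∞) ∧
    cellDensity s₀ s₁ = orthoschemeDensity s₀ s₁ ∧
    IsHoroballPacking (packing s₀ s₁) ∧
    IsPeriod (packing s₀ s₁) coxeterT cell ∧
    (∀ g ∈ coxeterT, coveredPart (packing s₀ s₁) (move g cell) = orthoschemeDensity s₀ s₁) ∧
    HasDensity (packing s₀ s₁) (orthoschemeDensity s₀ s₁) := by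
  have hcell : coveredPart (packing s₀ s₁) cell = orthoschemeDensity s₀ s₁ :=
    h.coveredPart_cell.trans h.cellDensity_eq
  exact ⟨⟨hypVol_orthoscheme_pos, hypVol_orthoscheme_lt_top⟩,
    ⟨hypVol_cell_pos, hypVol_cell_lt_top⟩, h.cellDensity_eq, h.isHoroballPacking,
    Permissible.isPeriod, fun g hg => (Permissible.coveredPart_move_cell hg).trans hcell,
    ⟨coxeterT, cell, Permissible.isPeriod⟩,
    fun Γ F hF => (h.coveredPart_eq_of_isPeriod hF).trans hcell⟩
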